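/- Let $(\lambda_k)_{k\ge 0}$ be a non-decreasing sequence of positive real numbers tending to $\infty$, let $1\le p<\infty$, and let $(a_k)_{k\ge 0}$ be a sequence of complex numbers. For a measurable set $E\subseteq\mathbb R$, functions $s_k:E\to\mathbb C$ ($k\ge 0$) are said to converge $\Lambda^2$-strongly to $s\in L^p(E)$ in the $L^p(E)$-metric if $$\lim_{n\to\infty}\Big\|\frac1{\lambda_n}\sum_{k=0}^{n}\big|\lambda_k(s_k-s)-\lambda_{k-2}(s_{k-2}-s)\big|\Big\|_{L^p(E)}=0,\qquad \lambda_{-1}=\lambda_{-2}=0,\quad s_{-1}=s_{-2}=0 .$$ Consider the condition $$\lim_{n\to\infty}\frac1{\lambda_n}\sum_{k=1}^{n}\lambda_{k-1}|a_k|=0. \tag{$*$}$$ (1) Let $A\subseteq\mathbb R$ be a Lebesgue measurable set of positive measure. If the sums $\sum_{k=1}^n a_k\cos kt$ and the sums $\sum_{k=1}^n a_k\sin kt$ ($n\ge 0$) both converge $\Lambda^2$-strongly in the $L^p(A)$-metric, each to some function in $L^p(A)$, then $(*)$ holds. (2) Suppose moreover that $1<p<\infty$, and let $f,g\in L^p[0,2\pi)$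 be complex-valued functions whose Fourier series are $\frac12a_0+\sum_{k=1}^\infty a_k\cos kt$ and $\sum_{k=1}^\infty a_k\sin kt$, respectively. Then the partial sums of these two Fourier series converge $\Lambda^2$-strongly in the $L^p[0,2\pi)$-metric to $f$ and to $g$, respectively, if and only if $(*)$ holds. -/

import Mathlib

open MeasureTheory Filter Topology
open scoped ENNReal

noncomputable section

namespace LambdaStrong

/-- The `n`-th mean `(1/λ_n) ∑_{k=0}^n |λ_k (s_k - s) - λ_{k-r} (s_{k-r} - s)|` of a sequence of
complex numbers, where `λ_{-1} = … = λ_{-r} = 0`, so that the second term is absent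
for `k < r`. -/
def strongMean (lam : ℕ → ℝ) (r : ℕ) (S : ℕ → ℂ) (s : ℂ) (n : ℕ) : ℝ :=
  1 / lam n * ∑ k ∈ Finset.range (n + 1),
    ‖(lam k : ℂ) * (S k - s) - (if k < r then 0 else (lam (k - r) : ℂ) * (S (k - r) - s))‖

/-- The functions `S 0, S 1, …` converge `Λ^r`-strongly to `s` in the metric of `L^p(μ)`:
the limit `s` is in `L^p(μ)` and the `L^p(μ)` norm of the means tends to `0`. -/
def ConvergesStronglyInLp (lam : ℕ → ℝ) (r : ℕ) (p : ℝ≥0∞) (μ : Measure ℝ)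
    (S : ℕ → ℝ → ℂ) (s : ℝ → ℂ) : Prop :=
  MemLp s p μ ∧
    Tendsto (fun n : ℕ => eLpNorm (fun t => strongMean lam r (fun k => S k t) (s t) n) p μ)
      atTop (𝓝 0)

/-- The cosine partial sums `∑_{k=1}^n a_k cos kt`. -/
def cosSum (a : ℕ → ℂ) (n : ℕ) (t : ℝ) : ℂ :=
  ∑ k ∈ Finset.Icc 1 n, a k * (Real.cos (k * t) : ℂ)

/-- The sine partial sums `∑_{k=1}^n a_k sin kt`. -/
def sinSum (a : ℕ → ℂ) (n : ℕ) (t : ℝ) : ℂ :=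
  ∑ k ∈ Finset.Icc 1 n, a k * (Real.sin (k * t) : ℂ)

/-- Lebesgue measure on the period `[0, 2π)`. -/
def periodMeasure : Measure ℝ := volume.restrict (Set.Ico 0 (2 * Real.pi))

/-- The Fourier coefficient `a_k(f) = (1/π) ∫_0^{2π} f(t) cos kt dt`. -/
def cosCoeff (f : ℝ → ℂ) (k : ℕ) : ℂ :=
  1 / (Real.pi : ℂ) * ∫ t, f t * (Real.cos (k * t) : ℂ) ∂periodMeasure

/-- The Fourier coefficient `b_k(f) = (1/π) ∫_0^{2π} f(t) sin kt dt`. -/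
def sinCoeff (f : ℝ → ℂ) (k : ℕ) : ℂ :=
  1 / (Real.pi : ℂ) * ∫ t, f t * (Real.sin (k * t) : ℂ) ∂periodMeasure

/-- The partial sum `s_n(f,t) = a_0(f)/2 + ∑_{k=1}^n (a_k(f) cos kt + b_k(f) sin kt)`. -/
def fourierSum (f : ℝ → ℂ) (n : ℕ) (t : ℝ) : ℂ :=
  1 / 2 * cosCoeff f 0 + ∑ k ∈ Finset.Icc 1 n,
    (cosCoeff f k * (Real.cos (k * t) : ℂ) + sinCoeff f k * (Real.sin (k * t) : ℂ))

/-- The Fourier series of `f` is the cosine series `a_0/2 + ∑_{k ≥ 1} a_k cos kt`. -/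
def HasCosineSeries (f : ℝ → ℂ) (a : ℕ → ℂ) : Prop :=
  (∀ k, cosCoeff f k = a k) ∧ ∀ k, 1 ≤ k → sinCoeff f k = 0

/-- The Fourier series of `g` is the sine series `∑_{k ≥ 1} a_k sin kt`. -/
def HasSineSeries (g : ℝ → ℂ) (a : ℕ → ℂ) : Prop :=
  (∀ k, cosCoeff g k = 0) ∧ ∀ k, 1 ≤ k → sinCoeff g k = a k

end LambdaStrong

end

/-!
Write `d_k = λ_k (s_k - s) - λ_{k-2} (s_{k-2} - s)`, `s_k` being the partial sums.

*Reduction.* Summing the `d_k` with `k` of one parity gives `|s_n - s| ≤ (1/λ_n) ∑ |d_k|`, so strong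
convergence contains convergence in `L^p`. Since the weights `λ_k - λ_{k-2}` define a regular
summation method (`tendsto_weighted_mean`), the identities
`λ_k (s_k - s_{k-2}) = d_k - (λ_k - λ_{k-2}) (s_{k-2} - s)` and
`d_k = λ_{k-2} (s_k - s_{k-2}) + (λ_k - λ_{k-2}) (s_k - s)` show that, apart from `s_n → s`, all
that matters is the size of the weighted means of the increments `|s_k - s_{k-2}|`.

*Necessity.* Cosine and sine increments combine to a unimodular multiple of
`a_k e^{it} + a_{k-1}`. On a set `B` of finite positive measure its `L^1` norm is at least
`c (|a_k| + |a_{k-1}|)` with `c > 0` (`le_integral_norm_mul_exp_add`), because the integral of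
`e^{it}` over `B` has absolute value strictly less than `|B|`. This gives the condition on `a`
(`tendsto_mean_of_convergesStrongly`).

*Sufficiency.* The increments are bounded uniformly in `t` by `|a_k| + |a_{k-1}|`, so what remains
(`convergesStronglyInLp_of_tendsto`) is that the partial sums converge in `L^p` for `1 < p < ∞`,
which is M. Riesz's theorem (`tendsto_eLpNorm_fourierSum_sub`). For `1 < p ≤ 2` and a polynomial `F`
with positive real part on the circle and real `F(0)`, the pointwise bound
`|F|^p ≤ A (Re F)^p - B Re (F^p)` and the mean value property of `F^p` give `‖F‖_p ≤ C ‖Re F‖_p`.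
An arbitrary polynomial is reduced to this case by approximating the positive and negative parts of
its real part; the remainder is uniformly small in its real part, hence small in `L^2`. Consequently
the projection onto nonnegative frequencies is bounded on trigonometric polynomials; modulation
and density extend the bound to the partial sum operators on `L^p`, uniformly in the order, and
duality covers `p ≥ 2`.
-/

namespace LambdaStrong

/-! ### Strong means and the necessity of the coefficient condition -/

/-- The weight `λ_{k-2}`, with the convention `λ_{-1} = λ_{-2} = 0`. -/
noncomputable def prevWeight (lam : ℕ → ℝ) (k : ℕ) : ℝ := if k < 2 then 0 else lam (k - 2)

/-- The difference `λ_k (s_k - s) - λ_{k-2} (s_{k-2} - s)`. -/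
noncomputable def strongDiff (lam : ℕ → ℝ) (S : ℕ → ℂ) (s : ℂ) (k : ℕ) : ℂ :=
  (lam k : ℂ) * (S k - s) - (if k < 2 then 0 else (lam (k - 2) : ℂ) * (S (k - 2) - s))

theorem strongMean_two (lam : ℕ → ℝ) (S : ℕ → ℂ) (s : ℂ) (n : ℕ) :
    strongMean lam 2 S s n = 1 / lam n * ∑ k ∈ Finset.range (n + 1), ‖strongDiff lam S s k‖ := rfl

theorem prevWeight_nonneg {lam : ℕ → ℝ} (hpos : ∀ k, 0 < lam k) (k : ℕ) :
    0 ≤ prevWeight lam k := by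
  unfold prevWeight; split_ifs
  · exact le_rfl
  · exact (hpos _).le

theorem prevWeight_le {lam : ℕ → ℝ} (hpos : ∀ k, 0 < lam k) (hmono : Monotone lam) (k : ℕ) :
    prevWeight lam k ≤ lam k := by
  unfold prevWeight; split_ifs
  · exact (hpos _).le
  · exact hmono (Nat.sub_le _ _)

theorem sum_sub_prevWeight (lam : ℕ → ℝ) (n : ℕ) :
    ∑ k ∈ Finset.range (n + 1), (lam k - prevWeight lam k) = lam n + prevWeight lam (n + 1) := by
  induction n with
  | zero => simp [prevWeight]
  | succ n ih =>
    rw [Finset.sum_range_succ, ih]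
    have : prevWeight lam (n + 1 + 1) = lam n := by simp [prevWeight]
    rw [this]; ring

/-- The weights `λ_k - λ_{k-2}` form a Toeplitz regular summation method: their means of a null
sequence are null. -/
theorem tendsto_weighted_mean {lam : ℕ → ℝ} (hpos : ∀ k, 0 < lam k) (hmono : Monotone lam)
    (hlim : Tendsto lam atTop atTop) {e : ℕ → ℝ} (he : Tendsto e atTop (𝓝 0)) :
    Tendsto (fun n => 1 / lam n * ∑ k ∈ Finset.range (n + 1), (lam k - prevWeight lam k) * e k)
      atTop (𝓝 0) := by
  have hw : ∀ k, 0 ≤ lam k - prevWeight lam k := fun k =>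
    sub_nonneg.2 (prevWeight_le hpos hmono k)
  have h1 : (fun k => (lam k - prevWeight lam k) * e k) =o[atTop]
      (fun k => lam k - prevWeight lam k) := by
    have := (Asymptotics.isBigO_refl (fun k => lam k - prevWeight lam k) atTop).mul_isLittleO
      ((Asymptotics.isLittleO_one_iff ℝ).2 he)
    simpa using this
  have hdiv : Tendsto (fun n => ∑ k ∈ Finset.range n, (lam k - prevWeight lam k)) atTop atTop := by
    refine (tendsto_add_atTop_iff_nat 1).1 (tendsto_atTop_mono (fun n => ?_) hlim)
    rw [sum_sub_prevWeight]
    linarith [prevWeight_nonneg hpos (n + 1)]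
  have h2 := (h1.sum_range hw hdiv).comp_tendsto (tendsto_add_atTop_nat 1)
  have h3 : (fun n => ∑ k ∈ Finset.range (n + 1), (lam k - prevWeight lam k)) =O[atTop] lam := by
    refine Asymptotics.IsBigO.of_bound 2 (Eventually.of_forall fun n => ?_)
    rw [sum_sub_prevWeight, Real.norm_of_nonneg
      (add_nonneg (hpos n).le (prevWeight_nonneg hpos _)), Real.norm_of_nonneg (hpos n).le]
    have : prevWeight lam (n + 1) ≤ lam n := by
      unfold prevWeight; split_ifs
      · exact (hpos _).le
      · exact hmono (by omega)
    linarith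
  have h4 := (h2.trans_isBigO h3).tendsto_div_nhds_zero
  refine h4.congr fun n => ?_
  simp [Function.comp, div_eq_inv_mul]

/-- The differences telescope along the indices of the parity of `n`. -/
theorem norm_le_sum_strongDiff {lam : ℕ → ℝ} (hpos : ∀ k, 0 < lam k) (S : ℕ → ℂ)
    (s : ℂ) (n : ℕ) :
    lam n * ‖S n - s‖ ≤ ∑ k ∈ Finset.range (n + 1), ‖strongDiff lam S s k‖ := by
  induction n using Nat.strong_induction_on with
  | _ n ih =>
    rw [Finset.sum_range_succ]
    rcases lt_or_ge n 2 with hn | hn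
    · have h0 : ‖strongDiff lam S s n‖ = lam n * ‖S n - s‖ := by
        simp [strongDiff, hn, abs_of_pos (hpos n)]
      rw [h0]
      have : 0 ≤ ∑ k ∈ Finset.range n, ‖strongDiff lam S s k‖ :=
        Finset.sum_nonneg fun _ _ => norm_nonneg _
      linarith
    · have h0 : (lam n : ℂ) * (S n - s)
          = strongDiff lam S s n + (lam (n - 2) : ℂ) * (S (n - 2) - s) := by
        simp [strongDiff, not_lt.2 hn]
      have h1 : lam n * ‖S n - s‖ ≤ ‖strongDiff lam S s n‖ + lam (n - 2) * ‖S (n - 2) - s‖ := by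
        have := norm_add_le (strongDiff lam S s n) ((lam (n - 2) : ℂ) * (S (n - 2) - s))
        rw [← h0] at this
        simpa [abs_of_pos (hpos _)] using this
      have h2 := ih (n - 2) (by omega)
      have h3 : ∑ k ∈ Finset.range (n - 2 + 1), ‖strongDiff lam S s k‖
          ≤ ∑ k ∈ Finset.range n, ‖strongDiff lam S s k‖ :=
        Finset.sum_le_sum_of_subset_of_nonneg
          (Finset.range_subset_range.2 (by omega)) fun _ _ _ => norm_nonneg _
      linarith

theorem norm_sub_le_strongMean {lam : ℕ → ℝ} (hpos : ∀ k, 0 < lam k) (S : ℕ → ℂ)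
    (s : ℂ) (n : ℕ) : ‖S n - s‖ ≤ strongMean lam 2 S s n := by
  rw [strongMean_two, one_div, ← div_eq_inv_mul, le_div_iff₀ (hpos n), mul_comm]
  exact norm_le_sum_strongDiff hpos S s n

/-- Here the weight `λ_k` is attached to the increment, so that the error involves the index `k - 2`;
its reverse `norm_strongDiff_le` attaches `λ_{k-2}` and involves the index `k`. -/
theorem mul_norm_sub_le_strongDiff {lam : ℕ → ℝ} (hpos : ∀ k, 0 < lam k)
    (hmono : Monotone lam) (S : ℕ → ℂ) (s : ℂ) {k : ℕ} (hk : 2 ≤ k) :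
    lam k * ‖S k - S (k - 2)‖
      ≤ ‖strongDiff lam S s k‖ + (lam k - prevWeight lam k) * ‖S (k - 2) - s‖ := by
  have h0 : (lam k : ℂ) * (S k - S (k - 2)) = strongDiff lam S s k
      - ((lam k - prevWeight lam k : ℝ) : ℂ) * (S (k - 2) - s) := by
    simp [strongDiff, prevWeight, not_lt.2 hk]; ring
  have h1 := norm_sub_le (strongDiff lam S s k)
    (((lam k - prevWeight lam k : ℝ) : ℂ) * (S (k - 2) - s))
  rw [← h0, norm_mul, norm_mul, Complex.norm_real, Complex.norm_real,
    Real.norm_of_nonneg (hpos k).le,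
    Real.norm_of_nonneg (sub_nonneg.2 (prevWeight_le hpos hmono k))] at h1
  exact h1

theorem norm_strongDiff_le {lam : ℕ → ℝ} (hpos : ∀ k, 0 < lam k)
    (hmono : Monotone lam) (S : ℕ → ℂ) (s : ℂ) (k : ℕ) :
    ‖strongDiff lam S s k‖ ≤ prevWeight lam k * ‖S k - S (k - 2)‖
      + (lam k - prevWeight lam k) * ‖S k - s‖ := by
  have h0 : strongDiff lam S s k = (prevWeight lam k : ℂ) * (S k - S (k - 2))
      + ((lam k - prevWeight lam k : ℝ) : ℂ) * (S k - s) := by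
    unfold strongDiff prevWeight; split_ifs <;> simp; ring
  rw [h0]
  refine (norm_add_le _ _).trans (le_of_eq ?_)
  rw [norm_mul, norm_mul, Complex.norm_real, Complex.norm_real,
    Real.norm_of_nonneg (prevWeight_nonneg hpos k),
    Real.norm_of_nonneg (sub_nonneg.2 (prevWeight_le hpos hmono k))]

theorem ConvergesStronglyInLp.mono_measure {lam : ℕ → ℝ} {r : ℕ} {p : ℝ≥0∞} {μ ν : Measure ℝ}
    {S : ℕ → ℝ → ℂ} {s : ℝ → ℂ} (h : ConvergesStronglyInLp lam r p μ S s) (hν : ν ≤ μ) :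
    ConvergesStronglyInLp lam r p ν S s :=
  ⟨h.1.mono_measure hν, tendsto_of_tendsto_of_tendsto_of_le_of_le tendsto_const_nhds h.2
    (fun _ => zero_le) (fun _ => eLpNorm_mono_measure _ hν)⟩

theorem integrable_strongDiff {ν : Measure ℝ} (lam : ℕ → ℝ) {S : ℕ → ℝ → ℂ} {s : ℝ → ℂ}
    (hS : ∀ k, Integrable (S k) ν) (hs : Integrable s ν) (k : ℕ) :
    Integrable (fun t => strongDiff lam (fun k => S k t) (s t) k) ν := by
  unfold strongDiff
  refine (((hS k).sub hs).const_mul _).sub ?_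
  split_ifs
  · exact integrable_zero _ _ _
  · exact ((hS _).sub hs).const_mul _

/-- On a finite measure space, `Λ²`-strong convergence forces the means of
`λ_k ‖s_k - s_{k-2}‖_{L¹}` to vanish. -/
theorem ConvergesStronglyInLp.tendsto_mean_integral {lam : ℕ → ℝ} (hpos : ∀ k, 0 < lam k)
    (hmono : Monotone lam) (hlim : Tendsto lam atTop atTop) {p : ℝ≥0∞} (hp1 : 1 ≤ p)
    {ν : Measure ℝ} [IsFiniteMeasure ν] {S : ℕ → ℝ → ℂ} {s : ℝ → ℂ}
    (hS : ∀ k, Integrable (S k) ν) (h : ConvergesStronglyInLp lam 2 p ν S s) :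
    Tendsto (fun n => 1 / lam n * ∑ k ∈ Finset.range (n + 1),
      if k < 2 then 0 else lam k * ∫ t, ‖S k t - S (k - 2) t‖ ∂ν) atTop (𝓝 0) := by
  have hs : Integrable s ν := h.1.integrable hp1
  have hD := integrable_strongDiff lam hS hs
  have hM : ∀ n, Integrable (fun t => strongMean lam 2 (fun k => S k t) (s t) n) ν := fun n =>
    (integrable_finsetSum _ fun k _ => (hD k).norm).const_mul _
  have hM0 : ∀ n t, 0 ≤ strongMean lam 2 (fun k => S k t) (s t) n := fun n t =>
    (norm_nonneg _).trans (norm_sub_le_strongMean hpos _ _ _)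
  have hMlim : Tendsto (fun n => ∫ t, strongMean lam 2 (fun k => S k t) (s t) n ∂ν)
      atTop (𝓝 0) := by
    have h1 : Tendsto (fun n => eLpNorm (fun t => strongMean lam 2 (fun k => S k t) (s t) n) 1 ν)
        atTop (𝓝 0) := by
      have h2 := ENNReal.Tendsto.mul_const (b := ν Set.univ ^ (1 / (1 : ℝ≥0∞).toReal - 1 / p.toReal))
        h.2 (Or.inr ?_)
      · rw [zero_mul] at h2
        exact tendsto_of_tendsto_of_tendsto_of_le_of_le tendsto_const_nhds h2 (fun _ => zero_le)
          (fun n => eLpNorm_le_eLpNorm_mul_rpow_measure_univ hp1 (hM n).1)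
      · refine ENNReal.rpow_ne_top_of_nonneg ?_ (measure_ne_top _ _)
        rcases eq_or_ne p ⊤ with rfl | hp
        · simp
        · have : 1 ≤ p.toReal := by
            simpa using (ENNReal.toReal_le_toReal ENNReal.one_ne_top hp).2 hp1
          simp only [ENNReal.toReal_one, sub_nonneg]
          exact one_div_le_one_div_of_le one_pos this
    have h3 := (ENNReal.tendsto_toReal ENNReal.zero_ne_top).comp h1
    refine h3.congr fun n => ?_
    rw [Function.comp_apply, eLpNorm_one_eq_lintegral_enorm,
      ← integral_norm_eq_lintegral_enorm (hM n).1]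
    exact integral_congr_ae (Eventually.of_forall fun t => Real.norm_of_nonneg (hM0 n t))
  have hMeq : ∀ n, ∫ t, strongMean lam 2 (fun k => S k t) (s t) n ∂ν
      = 1 / lam n * ∑ k ∈ Finset.range (n + 1),
        ∫ t, ‖strongDiff lam (fun k => S k t) (s t) k‖ ∂ν := fun n => by
    simp only [strongMean_two]
    rw [integral_const_mul, integral_finsetSum _ fun k _ => (hD k).norm]
  have he : Tendsto (fun n => ∫ t, ‖S n t - s t‖ ∂ν) atTop (𝓝 0) :=
    tendsto_of_tendsto_of_tendsto_of_le_of_le tendsto_const_nhds hMlim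
      (fun n => integral_nonneg fun _ => norm_nonneg _)
      (fun n => integral_mono ((hS n).sub hs).norm (hM n)
        fun t => norm_sub_le_strongMean hpos (fun k => S k t) _ _)
  have hshift : Tendsto (fun k : ℕ => ∫ t, ‖S (k - 2) t - s t‖ ∂ν) atTop (𝓝 0) :=
    he.comp (tendsto_sub_atTop_nat 2)
  have hw := tendsto_weighted_mean hpos hmono hlim hshift
  have hsum := hMlim.add hw
  rw [add_zero] at hsum
  refine tendsto_of_tendsto_of_tendsto_of_le_of_le tendsto_const_nhds hsum (fun n => ?_)
    (fun n => ?_)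
  · refine mul_nonneg (one_div_pos.2 (hpos n)).le (Finset.sum_nonneg fun k _ => ?_)
    split_ifs
    · exact le_rfl
    · exact mul_nonneg (hpos k).le (integral_nonneg fun _ => norm_nonneg _)
  · simp only []
    rw [hMeq, ← mul_add, ← Finset.sum_add_distrib]
    refine mul_le_mul_of_nonneg_left (Finset.sum_le_sum fun k _ => ?_)
      (one_div_pos.2 (hpos n)).le
    split_ifs with hk
    · exact add_nonneg (integral_nonneg fun _ => norm_nonneg _)
        (mul_nonneg (sub_nonneg.2 (prevWeight_le hpos hmono k))
          (integral_nonneg fun _ => norm_nonneg _))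
    · have hSs : Integrable (fun t => ‖S (k - 2) t - s t‖) ν := ((hS _).sub hs).norm
      have hSS : Integrable (fun t => ‖S k t - S (k - 2) t‖) ν := ((hS k).sub (hS _)).norm
      rw [← integral_const_mul, ← integral_const_mul, ← integral_add (hD k).norm
        (hSs.const_mul _)]
      exact integral_mono (hSS.const_mul _) ((hD k).norm.add (hSs.const_mul _))
        fun t => mul_norm_sub_le_strongDiff hpos hmono (fun k => S k t) (s t) (not_lt.1 hk)

/-- The function `e^{it}` is not almost everywhere constant for an atomless measure, so its mean
lies strictly inside the unit disc. -/
theorem norm_integral_exp_lt {ν : Measure ℝ} [IsFiniteMeasure ν] [NullSingletonClass ν] (hν : ν ≠ 0) :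
    ‖∫ t : ℝ, Complex.exp (t * Complex.I) ∂ν‖ < ν.real Set.univ := by
  rcases ae_eq_const_or_norm_integral_lt_of_norm_le_const (μ := ν)
    (f := fun t : ℝ => Complex.exp (t * Complex.I)) (C := 1)
    (Eventually.of_forall fun t => (Complex.norm_exp_ofReal_mul_I t).le) with h | h
  · exfalso
    set z := ⨍ t : ℝ, Complex.exp (t * Complex.I) ∂ν with hz
    have hc : {t : ℝ | Complex.exp (t * Complex.I) = z}.Countable := by
      rcases Set.eq_empty_or_nonempty {t : ℝ | Complex.exp (t * Complex.I) = z} with h0 | ⟨t₀, ht₀⟩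
      · rw [h0]; exact Set.countable_empty
      · refine (Set.countable_range fun n : ℤ => t₀ + n * (2 * Real.pi)).mono fun t ht => ?_
        have h1 : Complex.exp (t * Complex.I) = Complex.exp (t₀ * Complex.I) := by
          rw [Set.mem_ofPred_eq] at ht ht₀; rw [ht, ht₀]
        obtain ⟨n, hn⟩ := Complex.exp_eq_exp_iff_exists_int.1 h1
        refine ⟨n, ?_⟩
        have h2 : (t : ℂ) = t₀ + n * (2 * Real.pi) := by
          apply mul_right_cancel₀ Complex.I_ne_zero
          rw [hn]; ring
        exact_mod_cast h2.symm
    have h0 : ν {t : ℝ | Complex.exp (t * Complex.I) = z} = 0 := hc.measure_zero ν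
    have h1 : ∀ᵐ t : ℝ ∂ν, Complex.exp (t * Complex.I) ≠ z := by
      rw [ae_iff]; simpa using h0
    have : ∀ᵐ t ∂ν, False := by
      filter_upwards [h, h1] with t h2 h3
      exact h3 h2
    rw [eventually_false_iff_eq_bot, ae_eq_bot] at this
    exact hν this
  · simpa using h

/-- Integrating `x e^{it} + y` against `1` and against `e^{-it}` bounds both coefficients. -/
theorem le_integral_norm_mul_exp_add {ν : Measure ℝ} [IsFiniteMeasure ν] (x y : ℂ) :
    (ν.real Set.univ - ‖∫ t : ℝ, Complex.exp (t * Complex.I) ∂ν‖) / 2 * (‖x‖ + ‖y‖)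
      ≤ ∫ t : ℝ, ‖x * Complex.exp (t * Complex.I) + y‖ ∂ν := by
  set M := ν.real Set.univ
  set m := ∫ t : ℝ, Complex.exp (t * Complex.I) ∂ν
  have hb : ∀ g : ℝ → ℂ, Continuous g → (∀ t, ‖g t‖ ≤ 1) → Integrable g ν := fun g hg h1 =>
    Integrable.of_bound hg.aestronglyMeasurable 1 (Eventually.of_forall h1)
  have he : Integrable (fun t : ℝ => Complex.exp (t * Complex.I)) ν :=
    hb _ (by fun_prop) fun t => (Complex.norm_exp_ofReal_mul_I t).le
  have he' : Integrable (fun t : ℝ => (starRingEnd ℂ) (Complex.exp (t * Complex.I))) ν :=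
    hb _ (by fun_prop) fun t => by
      rw [RCLike.norm_conj]; exact (Complex.norm_exp_ofReal_mul_I t).le
  have h1 : x * m + M * y = ∫ t : ℝ, (x * Complex.exp (t * Complex.I) + y) ∂ν := by
    rw [integral_add (he.const_mul x) (integrable_const y), integral_const_mul, integral_const]
    simp [M, m]
  have h2 : M * x + (starRingEnd ℂ) m * y = ∫ t : ℝ,
      (starRingEnd ℂ) (Complex.exp (t * Complex.I)) * (x * Complex.exp (t * Complex.I) + y) ∂ν := by
    have : ∀ t : ℝ, (starRingEnd ℂ) (Complex.exp (t * Complex.I))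
        * (x * Complex.exp (t * Complex.I) + y)
        = x + (starRingEnd ℂ) (Complex.exp (t * Complex.I)) * y := fun t => by
      have h3 : (starRingEnd ℂ) (Complex.exp (t * Complex.I)) * Complex.exp (t * Complex.I) = 1 := by
        rw [mul_comm, Complex.mul_conj, Complex.normSq_eq_norm_sq, Complex.norm_exp_ofReal_mul_I]
        simp
      linear_combination x * h3
    simp_rw [this]
    rw [integral_add (integrable_const x) (he'.mul_const y), integral_mul_const, integral_const,
      integral_conj]
    simp [M, m]
  have h3 : ‖x * m + M * y‖ ≤ ∫ t : ℝ, ‖x * Complex.exp (t * Complex.I) + y‖ ∂ν := by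
    rw [h1]; exact norm_integral_le_integral_norm _
  have h4 : ‖M * x + (starRingEnd ℂ) m * y‖
      ≤ ∫ t : ℝ, ‖x * Complex.exp (t * Complex.I) + y‖ ∂ν := by
    rw [h2]
    refine (norm_integral_le_integral_norm _).trans (le_of_eq ?_)
    refine integral_congr_ae (Eventually.of_forall fun t => ?_)
    simp only [norm_mul, RCLike.norm_conj, Complex.norm_exp_ofReal_mul_I, one_mul]
  have hM : 0 ≤ M := measureReal_nonneg
  have h5 : M * ‖y‖ ≤ ‖x * m + M * y‖ + ‖x‖ * ‖m‖ := by
    have := norm_sub_le (x * m + M * y) (x * m)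
    rw [add_sub_cancel_left, norm_mul, norm_mul, Complex.norm_real, Real.norm_of_nonneg hM] at this
    exact this
  have h6 : M * ‖x‖ ≤ ‖M * x + (starRingEnd ℂ) m * y‖ + ‖m‖ * ‖y‖ := by
    have := norm_sub_le (M * x + (starRingEnd ℂ) m * y) ((starRingEnd ℂ) m * y)
    rw [add_sub_cancel_right, norm_mul, norm_mul, Complex.norm_real, Real.norm_of_nonneg hM,
      RCLike.norm_conj] at this
    exact this
  nlinarith

theorem cosSum_sub (a : ℕ → ℂ) {k : ℕ} (hk : 2 ≤ k) (t : ℝ) :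
    cosSum a k t - cosSum a (k - 2) t
      = a k * (Real.cos (k * t) : ℂ) + a (k - 1) * (Real.cos ((k - 1 : ℕ) * t) : ℂ) := by
  obtain ⟨k, rfl⟩ := Nat.exists_eq_add_of_le' hk
  rw [show k + 2 - 2 = k by omega, show k + 2 - 1 = k + 1 by omega]
  unfold cosSum
  rw [Finset.sum_Icc_succ_top (by omega), Finset.sum_Icc_succ_top (by omega)]
  ring

theorem sinSum_sub (a : ℕ → ℂ) {k : ℕ} (hk : 2 ≤ k) (t : ℝ) :
    sinSum a k t - sinSum a (k - 2) t
      = a k * (Real.sin (k * t) : ℂ) + a (k - 1) * (Real.sin ((k - 1 : ℕ) * t) : ℂ) := by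
  obtain ⟨k, rfl⟩ := Nat.exists_eq_add_of_le' hk
  rw [show k + 2 - 2 = k by omega, show k + 2 - 1 = k + 1 by omega]
  unfold sinSum
  rw [Finset.sum_Icc_succ_top (by omega), Finset.sum_Icc_succ_top (by omega)]
  ring

theorem norm_mul_exp_add_le (a : ℕ → ℂ) {k : ℕ} (hk : 2 ≤ k) (t : ℝ) :
    ‖a k * Complex.exp (t * Complex.I) + a (k - 1)‖
      ≤ ‖cosSum a k t - cosSum a (k - 2) t‖ + ‖sinSum a k t - sinSum a (k - 2) t‖ := by
  have h : (cosSum a k t - cosSum a (k - 2) t) + Complex.I * (sinSum a k t - sinSum a (k - 2) t)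
      = Complex.exp (((k - 1 : ℕ) * t : ℝ) * Complex.I)
        * (a k * Complex.exp (t * Complex.I) + a (k - 1)) := by
    have h1 : Complex.exp (((k - 1 : ℕ) * t : ℝ) * Complex.I) * Complex.exp (t * Complex.I)
        = Complex.exp ((k * t : ℝ) * Complex.I) := by
      rw [← Complex.exp_add]; congr 1
      push_cast [Nat.cast_sub (show 1 ≤ k by omega)]; ring
    have h2 : ∀ r : ℝ, Complex.exp (r * Complex.I) = (Real.cos r : ℂ) + Real.sin r * Complex.I :=
      fun r => by rw [Complex.exp_mul_I]; push_cast; rfl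
    rw [cosSum_sub a hk, sinSum_sub a hk]
    linear_combination -a k * h1 - a k * h2 (k * t) - a (k - 1) * h2 ((k - 1 : ℕ) * t)
  calc ‖a k * Complex.exp (t * Complex.I) + a (k - 1)‖
      = ‖(cosSum a k t - cosSum a (k - 2) t)
          + Complex.I * (sinSum a k t - sinSum a (k - 2) t)‖ := by
        rw [h, norm_mul, Complex.norm_exp_ofReal_mul_I, one_mul]
    _ ≤ _ := by
        refine (norm_add_le _ _).trans (le_of_eq ?_)
        rw [norm_mul, Complex.norm_I, one_mul]

theorem continuous_cosSum (a : ℕ → ℂ) (n : ℕ) : Continuous (cosSum a n) := by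
  unfold cosSum
  fun_prop

theorem continuous_sinSum (a : ℕ → ℂ) (n : ℕ) : Continuous (sinSum a n) := by
  unfold sinSum
  fun_prop

theorem norm_cosSum_le (a : ℕ → ℂ) (n : ℕ) (t : ℝ) :
    ‖cosSum a n t‖ ≤ ∑ k ∈ Finset.Icc 1 n, ‖a k‖ := by
  refine norm_sum_le_of_le _ fun k _ => ?_
  rw [norm_mul, Complex.norm_real]
  exact mul_le_of_le_one_right (norm_nonneg _) (Real.abs_cos_le_one _)

theorem norm_sinSum_le (a : ℕ → ℂ) (n : ℕ) (t : ℝ) :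
    ‖sinSum a n t‖ ≤ ∑ k ∈ Finset.Icc 1 n, ‖a k‖ := by
  refine norm_sum_le_of_le _ fun k _ => ?_
  rw [norm_mul, Complex.norm_real]
  exact mul_le_of_le_one_right (norm_nonneg _) (Real.abs_sin_le_one _)

/-- The coefficient condition is necessary on any nonzero finite atomless measure. -/
theorem tendsto_mean_of_finite {lam : ℕ → ℝ} (hpos : ∀ k, 0 < lam k)
    (hmono : Monotone lam) (hlim : Tendsto lam atTop atTop) {p : ℝ≥0∞} (hp1 : 1 ≤ p)
    {ν : Measure ℝ} [IsFiniteMeasure ν] [NullSingletonClass ν] (hν : ν ≠ 0) {a : ℕ → ℂ} {s₁ s₂ : ℝ → ℂ}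
    (h₁ : ConvergesStronglyInLp lam 2 p ν (cosSum a) s₁)
    (h₂ : ConvergesStronglyInLp lam 2 p ν (sinSum a) s₂) :
    Tendsto (fun n : ℕ => 1 / lam n * ∑ k ∈ Finset.Icc 1 n, lam (k - 1) * ‖a k‖)
      atTop (𝓝 0) := by
  have hc : ∀ k, Integrable (cosSum a k) ν := fun k =>
    Integrable.of_bound (continuous_cosSum a k).aestronglyMeasurable _
      (Eventually.of_forall (norm_cosSum_le a k))
  have hs : ∀ k, Integrable (sinSum a k) ν := fun k =>
    Integrable.of_bound (continuous_sinSum a k).aestronglyMeasurable _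
      (Eventually.of_forall (norm_sinSum_le a k))
  have l₁ := h₁.tendsto_mean_integral hpos hmono hlim hp1 hc
  have l₂ := h₂.tendsto_mean_integral hpos hmono hlim hp1 hs
  set δ := (ν.real Set.univ - ‖∫ t : ℝ, Complex.exp (t * Complex.I) ∂ν‖) / 2 with hδ
  have hδ0 : 0 < δ := by
    have := norm_integral_exp_lt hν
    rw [hδ]; linarith
  have hinv : Tendsto (fun n => 1 / lam n * (lam 0 * ‖a 1‖)) atTop (𝓝 0) := by
    have := (tendsto_inv_atTop_zero.comp hlim).mul_const (lam 0 * ‖a 1‖)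
    simpa [Function.comp_def, one_div] using this
  have hall := hinv.add ((l₁.add l₂).const_mul δ⁻¹)
  simp only [add_zero, mul_zero] at hall
  refine tendsto_of_tendsto_of_tendsto_of_le_of_le tendsto_const_nhds hall (fun n => ?_)
    (fun n => ?_)
  · exact mul_nonneg (one_div_pos.2 (hpos n)).le (Finset.sum_nonneg fun k _ =>
      mul_nonneg (hpos _).le (norm_nonneg _))
  · simp only []
    rw [← mul_add, mul_left_comm δ⁻¹, ← mul_add, ← Finset.sum_add_distrib, Finset.mul_sum _ _ δ⁻¹]
    refine mul_le_mul_of_nonneg_left ?_ (one_div_pos.2 (hpos n)).le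
    have hterm : ∀ k, lam (k - 1) * (if k < 2 then 0 else ‖a k‖) ≤ δ⁻¹ *
        ((if k < 2 then 0 else lam k * ∫ t, ‖cosSum a k t - cosSum a (k - 2) t‖ ∂ν)
        + (if k < 2 then 0 else lam k * ∫ t, ‖sinSum a k t - sinSum a (k - 2) t‖ ∂ν)) := by
      intro k
      split_ifs with hk
      · simp
      · have hk := not_lt.1 hk
        have h1 := le_integral_norm_mul_exp_add (ν := ν) (a k) (a (k - 1))
        have h2 : ∫ t : ℝ, ‖a k * Complex.exp (t * Complex.I) + a (k - 1)‖ ∂ν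
            ≤ ∫ t, ‖cosSum a k t - cosSum a (k - 2) t‖ ∂ν
              + ∫ t, ‖sinSum a k t - sinSum a (k - 2) t‖ ∂ν := by
          have i₁ : Integrable (fun t => ‖cosSum a k t - cosSum a (k - 2) t‖) ν :=
            ((hc _).sub (hc _)).norm
          have i₂ : Integrable (fun t => ‖sinSum a k t - sinSum a (k - 2) t‖) ν :=
            ((hs _).sub (hs _)).norm
          rw [← integral_add i₁ i₂]
          refine integral_mono_of_nonneg (Eventually.of_forall fun _ => norm_nonneg _) (i₁.add i₂)
            (Eventually.of_forall fun t => norm_mul_exp_add_le a hk t)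
        rw [← hδ] at h1
        have h3 : δ * ‖a k‖ ≤ ∫ t, ‖cosSum a k t - cosSum a (k - 2) t‖ ∂ν
              + ∫ t, ‖sinSum a k t - sinSum a (k - 2) t‖ ∂ν := by
          have := mul_nonneg hδ0.le (norm_nonneg (a (k - 1)))
          linarith
        rw [← mul_add, le_inv_mul_iff₀ hδ0]
        calc δ * (lam (k - 1) * ‖a k‖) = lam (k - 1) * (δ * ‖a k‖) := by ring
          _ ≤ lam k * _ := mul_le_mul (hmono (Nat.sub_le _ _)) h3
            (mul_nonneg hδ0.le (norm_nonneg _)) (hpos k).le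
    calc ∑ k ∈ Finset.Icc 1 n, lam (k - 1) * ‖a k‖
        ≤ ∑ k ∈ Finset.range (n + 1), ((if k = 1 then lam 0 * ‖a 1‖ else 0)
            + lam (k - 1) * (if k < 2 then 0 else ‖a k‖)) := by
          refine (Finset.sum_le_sum fun k hk => ?_).trans
            (Finset.sum_le_sum_of_subset_of_nonneg (s := Finset.Icc 1 n) ?_ ?_)
          · have := (Finset.mem_Icc.1 hk).1
            by_cases h1 : k = 1
            · subst h1; simp
            · simp [h1, show ¬ k < 2 by omega]
          · intro k hk
            rw [Finset.mem_Icc] at hk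
            exact Finset.mem_range.2 (by omega)
          · intro k _ _
            refine add_nonneg ?_ (mul_nonneg (hpos _).le ?_) <;> split_ifs <;>
              first | exact le_rfl | exact norm_nonneg _ |
                exact mul_nonneg (hpos _).le (norm_nonneg _)
      _ ≤ _ := by
          rw [Finset.sum_add_distrib]
          refine add_le_add ?_ (Finset.sum_le_sum fun k _ => hterm k)
          rw [Finset.sum_ite_eq']
          split_ifs
          · exact le_rfl
          · exact mul_nonneg (hpos _).le (norm_nonneg _)

/-- A set of positive Lebesgue measure contains a bounded set of positive measure. -/
theorem exists_restrict_le_of_pos {A : Set ℝ} (hA : 0 < volume A) :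
    ∃ B : Set ℝ, B ⊆ A ∧ 0 < volume B ∧ volume B < ⊤ := by
  have hU : A = ⋃ n : ℕ, A ∩ Set.Icc (-(n : ℝ)) n := by
    rw [← Set.inter_iUnion]
    refine (Set.inter_eq_left.2 fun t _ => ?_).symm
    obtain ⟨n, hn⟩ := exists_nat_ge |t|
    exact Set.mem_iUnion.2 ⟨n, abs_le.1 hn⟩
  by_contra! hcon
  have : volume A = 0 := by
    rw [hU, measure_iUnion_null_iff]
    intro n
    by_contra h0
    have hlt : volume (A ∩ Set.Icc (-(n : ℝ)) n) < ⊤ :=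
      (measure_mono Set.inter_subset_right).trans_lt measure_Icc_lt_top
    exact absurd hlt (not_lt.2 (hcon _ Set.inter_subset_left (pos_iff_ne_zero.2 h0)))
  exact hA.ne' this

theorem tendsto_mean_of_convergesStrongly {lam : ℕ → ℝ} (hpos : ∀ k, 0 < lam k)
    (hmono : Monotone lam) (hlim : Tendsto lam atTop atTop) {p : ℝ≥0∞} (hp1 : 1 ≤ p)
    {A : Set ℝ} (hA : 0 < volume A) {a : ℕ → ℂ} {s₁ s₂ : ℝ → ℂ}
    (h₁ : ConvergesStronglyInLp lam 2 p (volume.restrict A) (cosSum a) s₁)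
    (h₂ : ConvergesStronglyInLp lam 2 p (volume.restrict A) (sinSum a) s₂) :
    Tendsto (fun n : ℕ => 1 / lam n * ∑ k ∈ Finset.Icc 1 n, lam (k - 1) * ‖a k‖)
      atTop (𝓝 0) := by
  obtain ⟨B, hBA, hB0, hB⟩ := exists_restrict_le_of_pos hA
  have hle : volume.restrict B ≤ volume.restrict A := Measure.restrict_mono hBA le_rfl
  have : IsFiniteMeasure (volume.restrict B) := ⟨by simpa using hB⟩
  exact tendsto_mean_of_finite hpos hmono hlim hp1
    (fun h => hB0.ne' (Measure.restrict_eq_zero.1 h)) (h₁.mono_measure hle) (h₂.mono_measure hle)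

/-! ### Riesz's inequality for polynomials with positive real part -/

open Polynomial in
/-- The trace of a polynomial on the unit circle, `t ↦ F(e^{it})`. -/
noncomputable def circleTrace (F : ℂ[X]) (t : ℝ) : ℂ := F.eval (Complex.exp (t * Complex.I))

instance : IsFiniteMeasure periodMeasure := by
  unfold periodMeasure; infer_instance

theorem continuous_circleTrace (F : Polynomial ℂ) : Continuous (circleTrace F) := by
  unfold circleTrace
  exact F.continuous.comp (by fun_prop)

/-- A continuous function is bounded on the period, hence in every `L^p`. -/
theorem memLp_of_continuous {E : Type*} [NormedAddCommGroup E] [SecondCountableTopology E]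
    {f : ℝ → E} (hf : Continuous f)
    (p : ℝ≥0∞) : MemLp f p periodMeasure := by
  obtain ⟨C, hC⟩ := isCompact_Icc.exists_bound_of_continuousOn (s := Set.Icc 0 (2 * Real.pi))
    hf.continuousOn
  refine MemLp.of_bound hf.aestronglyMeasurable C ?_
  unfold periodMeasure
  exact (ae_restrict_iff' measurableSet_Ico).2
    (Eventually.of_forall fun t ht => hC t (Set.Ico_subset_Icc_self ht))

theorem integrable_of_continuous {E : Type*} [NormedAddCommGroup E] [SecondCountableTopology E]
    {f : ℝ → E} (hf : Continuous f) :
    Integrable f periodMeasure := memLp_one_iff_integrable.1 (memLp_of_continuous hf 1)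

theorem integral_period_eq (g : ℂ → ℂ) :
    ∫ t, g (Complex.exp (t * Complex.I)) ∂periodMeasure
      = (2 * Real.pi : ℝ) * Real.circleAverage g 0 1 := by
  unfold periodMeasure Real.circleAverage
  rw [intervalIntegral.integral_of_le Real.two_pi_pos.le, integral_Ico_eq_integral_Ioc,
    Complex.real_smul, ← mul_assoc, ← Complex.ofReal_mul, mul_inv_cancel₀ Real.two_pi_pos.ne']
  simp [circleMap]

/-- In polar form this is `1 ≤ A cos^q φ - B cos (q φ)` for `|φ| < π / 2`: near the ends of the range
`cos (q φ)` is negative since `1 < q ≤ 2`, elsewhere `cos φ` is bounded away from `0`. -/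
theorem exists_norm_rpow_le {q : ℝ} (hq1 : 1 < q) (hq2 : q ≤ 2) :
    ∃ A B : ℝ, 0 ≤ A ∧ 0 ≤ B ∧ ∀ w : ℂ, 0 < w.re →
      ‖w‖ ^ q ≤ A * w.re ^ q - B * (w ^ (q : ℂ)).re := by
  have hq0 : 0 < q := by linarith
  have hpi := Real.pi_pos
  -- `φ₀` is the midpoint of `π/(2q)` and `π/2`: there `cos (q φ)` is already negative, while
  -- `cos φ` is still positive.
  set φ₀ : ℝ := (Real.pi / (2 * q) + Real.pi / 2) / 2 with hφ₀
  have h1 : Real.pi / (2 * q) < Real.pi / 2 :=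
    div_lt_div_of_pos_left hpi two_pos (by linarith)
  have h0 : 0 < Real.pi / (2 * q) := by positivity
  have hqφ : Real.pi / 2 < q * φ₀ := by
    have : q * (Real.pi / (2 * q)) = Real.pi / 2 := by field_simp
    have h2 : q * (Real.pi / (2 * q)) < q * φ₀ := mul_lt_mul_of_pos_left (by linarith) hq0
    linarith
  have hqpi : q * (Real.pi / 2) ≤ Real.pi := by nlinarith
  have hqφ' : q * φ₀ ≤ Real.pi :=
    (mul_le_mul_of_nonneg_left (by linarith : φ₀ ≤ Real.pi / 2) hq0.le).trans hqpi
  have hcneg : Real.cos (q * φ₀) < 0 :=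
    Real.cos_neg_of_pi_div_two_lt_of_lt hqφ (by linarith)
  have hcpos : 0 < Real.cos φ₀ := Real.cos_pos_of_mem_Ioo ⟨by linarith, by linarith⟩
  set B : ℝ := (-Real.cos (q * φ₀))⁻¹ with hB
  have hB0 : 0 < B := inv_pos.2 (by linarith)
  set A : ℝ := (1 + B) / Real.cos φ₀ ^ q with hA
  have hcq : 0 < Real.cos φ₀ ^ q := Real.rpow_pos_of_pos hcpos q
  have hA0 : 0 < A := by positivity
  have key : ∀ φ : ℝ, 0 ≤ φ → φ < Real.pi / 2 →
      1 ≤ A * Real.cos φ ^ q - B * Real.cos (φ * q) := by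
    intro φ hφ hφ2
    have hcφ : 0 < Real.cos φ := Real.cos_pos_of_mem_Ioo ⟨by linarith, hφ2⟩
    rcases le_total φ φ₀ with h | h
    · have h2 : Real.cos φ₀ ^ q ≤ Real.cos φ ^ q := Real.rpow_le_rpow hcpos.le
        (Real.cos_le_cos_of_nonneg_of_le_pi hφ (by linarith) h) hq0.le
      have h3 : 1 + B ≤ A * Real.cos φ ^ q := by
        calc 1 + B = A * Real.cos φ₀ ^ q := by rw [hA, div_mul_cancel₀ _ hcq.ne']
          _ ≤ _ := mul_le_mul_of_nonneg_left h2 hA0.le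
      have h4 : B * Real.cos (φ * q) ≤ B * 1 :=
        mul_le_mul_of_nonneg_left (Real.cos_le_one _) hB0.le
      linarith
    · have h2 : Real.cos (φ * q) ≤ Real.cos (q * φ₀) := by
        refine Real.cos_le_cos_of_nonneg_of_le_pi (by linarith) ?_ ?_
        · nlinarith
        · rw [mul_comm]; exact mul_le_mul_of_nonneg_right h hq0.le
      have h3 : B * Real.cos (φ * q) ≤ B * Real.cos (q * φ₀) :=
        mul_le_mul_of_nonneg_left h2 hB0.le
      have h4 : B * Real.cos (q * φ₀) = -1 := by
        rw [hB, inv_neg, neg_mul, inv_mul_cancel₀ hcneg.ne]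
      have h5 : 0 ≤ A * Real.cos φ ^ q := by positivity
      linarith
  refine ⟨A, B, hA0.le, hB0.le, fun w hw => ?_⟩
  have harg : |Complex.arg w| < Real.pi / 2 :=
    Complex.abs_arg_lt_pi_div_two_iff.2 (Or.inl hw)
  have hk := key |Complex.arg w| (abs_nonneg _) harg
  rw [Real.cos_abs, show |Complex.arg w| * q = |Complex.arg w * q| by
    rw [abs_mul, abs_of_pos hq0], Real.cos_abs] at hk
  have hc0 : 0 ≤ Real.cos (Complex.arg w) :=
    Real.cos_nonneg_of_mem_Icc ⟨(abs_lt.1 harg).1.le, (abs_lt.1 harg).2.le⟩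
  rw [Complex.cpow_ofReal_re, ← Complex.norm_mul_cos_arg w, Real.mul_rpow (norm_nonneg _) hc0]
  have h6 := mul_le_mul_of_nonneg_left hk (Real.rpow_nonneg (norm_nonneg w) q)
  linarith

/-- Minimum principle for the real part of a polynomial on the closed unit disc. -/
theorem le_re_eval {F : Polynomial ℂ} {δ : ℝ} (hF : ∀ t, δ ≤ (circleTrace F t).re) {z : ℂ}
    (hz : z ∈ Metric.closedBall (0 : ℂ) 1) : δ ≤ (F.eval z).re := by
  have h := Complex.norm_le_of_forall_mem_frontier_norm_le (f := fun z => Complex.exp (-F.eval z))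
    (U := Metric.ball 0 1) (C := Real.exp (-δ)) Metric.isBounded_ball
    (Differentiable.diffContOnCl (F.differentiable.neg.cexp)) ?_ (z := z) ?_
  · rw [Complex.norm_exp, Real.exp_le_exp, Complex.neg_re] at h
    linarith
  · intro w hw
    rw [frontier_ball _ one_ne_zero, mem_sphere_zero_iff_norm] at hw
    rw [Complex.norm_exp, Real.exp_le_exp, Complex.neg_re, neg_le_neg_iff]
    have := hF (Complex.arg w)
    have hw' : Complex.exp (Complex.arg w * Complex.I) = w := by
      have := Complex.norm_mul_exp_arg_mul_I w
      rwa [hw, Complex.ofReal_one, one_mul] at this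
    rwa [circleTrace, hw'] at this
  · rwa [closure_ball _ one_ne_zero]

theorem integral_cpow_circleTrace {F : Polynomial ℂ} {δ : ℝ} (hδ : 0 < δ)
    (hF : ∀ t, δ ≤ (circleTrace F t).re) (q : ℂ) :
    ∫ t, circleTrace F t ^ q ∂periodMeasure = (2 * Real.pi : ℝ) * F.eval 0 ^ q := by
  have hd : DiffContOnCl ℂ (fun z => F.eval z ^ q) (Metric.ball 0 |1|) := by
    rw [abs_one]
    refine DifferentiableOn.diffContOnCl_ball (U := Metric.closedBall 0 1) (fun z hz => ?_) le_rfl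
    refine (F.differentiable.differentiableAt.cpow_const ?_).differentiableWithinAt
    exact Or.inl (hδ.trans_le (le_re_eval hF hz))
  rw [← hd.circleAverage]
  exact integral_period_eq fun z => F.eval z ^ q

theorem integral_sq_circleTrace (F : Polynomial ℂ) :
    ∫ t, circleTrace F t ^ 2 ∂periodMeasure = (2 * Real.pi : ℝ) * F.eval 0 ^ 2 := by
  have hd : DiffContOnCl ℂ (fun z => F.eval z ^ 2) (Metric.ball 0 |1|) :=
    Differentiable.diffContOnCl (F.differentiable.pow 2)
  rw [← hd.circleAverage]
  exact integral_period_eq fun z => F.eval z ^ 2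

theorem eLpNorm_le_of_integral_rpow_le {p : ℝ≥0∞} (hp0 : p ≠ 0) (hp : p ≠ ⊤) {E G : Type*}
    [NormedAddCommGroup E] [NormedAddCommGroup G] {μ : Measure ℝ} {f : ℝ → E} {g : ℝ → G}
    (hf : MemLp f p μ) (hg : MemLp g p μ) {A : ℝ} (hA : 0 ≤ A)
    (h : ∫ t, ‖f t‖ ^ p.toReal ∂μ ≤ A * ∫ t, ‖g t‖ ^ p.toReal ∂μ) :
    eLpNorm f p μ ≤ ENNReal.ofReal (A ^ p.toReal⁻¹) * eLpNorm g p μ := by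
  have hI : 0 ≤ ∫ t, ‖g t‖ ^ p.toReal ∂μ :=
    integral_nonneg fun _ => Real.rpow_nonneg (norm_nonneg _) _
  rw [hf.eLpNorm_eq_integral_rpow_norm hp0 hp, hg.eLpNorm_eq_integral_rpow_norm hp0 hp,
    ← ENNReal.ofReal_mul (Real.rpow_nonneg hA _), ← Real.mul_rpow hA hI]
  exact ENNReal.ofReal_le_ofReal (Real.rpow_le_rpow
    (integral_nonneg fun _ => Real.rpow_nonneg (norm_nonneg _) _) h
    (inv_nonneg.2 ENNReal.toReal_nonneg))

/-- M. Riesz's inequality for polynomials with positive real part: the mean value of `F^p` is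
`F(0)^p ≥ 0`, and `|F|^p` is dominated by `A (Re F)^p - B Re F^p`. -/
theorem exists_eLpNorm_le_of_re_pos {p : ℝ≥0∞} (hp1 : 1 < p) (hp2 : p ≤ 2) :
    ∃ C : ℝ≥0∞, C ≠ ⊤ ∧ ∀ (F : Polynomial ℂ) (δ : ℝ), 0 < δ → (∀ t, δ ≤ (circleTrace F t).re) →
      (F.eval 0).im = 0 →
      eLpNorm (circleTrace F) p periodMeasure
        ≤ C * eLpNorm (fun t => (circleTrace F t).re) p periodMeasure := by
  have hp : p ≠ ⊤ := ne_top_of_le_ne_top ENNReal.ofNat_ne_top hp2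
  have hq1 : 1 < p.toReal := by
    simpa using (ENNReal.toReal_lt_toReal ENNReal.one_ne_top hp).2 hp1
  have hq2 : p.toReal ≤ 2 := by
    simpa using (ENNReal.toReal_le_toReal hp ENNReal.ofNat_ne_top).2 hp2
  obtain ⟨A, B, hA, hB, hAB⟩ := exists_norm_rpow_le hq1 hq2
  refine ⟨ENNReal.ofReal (A ^ p.toReal⁻¹), ENNReal.ofReal_ne_top, fun F δ hδ hF h0 => ?_⟩
  have hcont := continuous_circleTrace F
  have hre : Continuous fun t => (circleTrace F t).re := Complex.continuous_re.comp hcont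
  refine eLpNorm_le_of_integral_rpow_le (one_pos.trans hp1).ne' hp (memLp_of_continuous hcont p)
    (memLp_of_continuous hre p) hA ?_
  have hpos : ∀ t, 0 < (circleTrace F t).re := fun t => hδ.trans_le (hF t)
  have i₁ : Integrable (fun t => ‖circleTrace F t‖ ^ p.toReal) periodMeasure :=
    integrable_of_continuous (hcont.norm.rpow_const fun _ => Or.inr (by linarith))
  have i₂ : Integrable (fun t => ‖(circleTrace F t).re‖ ^ p.toReal) periodMeasure :=
    integrable_of_continuous (hre.norm.rpow_const fun _ => Or.inr (by linarith))
  have i₃ : Integrable (fun t => circleTrace F t ^ (p.toReal : ℂ)) periodMeasure :=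
    integrable_of_continuous (hcont.cpow continuous_const fun t => Or.inl (hpos t))
  have i₄ : Integrable (fun t => (circleTrace F t ^ (p.toReal : ℂ)).re) periodMeasure := i₃.re
  have hm : 0 ≤ ∫ t, (circleTrace F t ^ (p.toReal : ℂ)).re ∂periodMeasure := by
    have h1 := congrArg Complex.re (integral_cpow_circleTrace hδ hF (p.toReal : ℂ))
    have h2 : (∫ t, circleTrace F t ^ (p.toReal : ℂ) ∂periodMeasure).re
        = ∫ t, (circleTrace F t ^ (p.toReal : ℂ)).re ∂periodMeasure := (integral_re i₃).symm
    rw [← h2, h1]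
    have h3 : 0 ≤ (F.eval 0).re := hδ.le.trans (le_re_eval hF (by simp))
    have h4 : F.eval 0 = ((F.eval 0).re : ℂ) := Complex.ext (by simp) (by simp [h0])
    rw [h4, ← Complex.ofReal_cpow h3, ← Complex.ofReal_mul, Complex.ofReal_re]
    exact mul_nonneg Real.two_pi_pos.le (Real.rpow_nonneg h3 _)
  calc ∫ t, ‖circleTrace F t‖ ^ p.toReal ∂periodMeasure
      ≤ ∫ t, (A * ‖(circleTrace F t).re‖ ^ p.toReal
          - B * (circleTrace F t ^ (p.toReal : ℂ)).re) ∂periodMeasure := by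
        refine integral_mono i₁ ((i₂.const_mul A).sub (i₄.const_mul B)) fun t => ?_
        have := hAB _ (hpos t)
        rwa [← Real.norm_of_nonneg (hpos t).le] at this
    _ = A * ∫ t, ‖(circleTrace F t).re‖ ^ p.toReal ∂periodMeasure
          - B * ∫ t, (circleTrace F t ^ (p.toReal : ℂ)).re ∂periodMeasure := by
        rw [integral_sub (i₂.const_mul A) (i₄.const_mul B), integral_const_mul,
          integral_const_mul]
    _ ≤ _ := sub_le_self _ (mul_nonneg hB hm)

/-- For `p = 2` positivity of the real part is not needed: `|F|² = 2 (Re F)² - Re F²` and the mean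
value of `F²` is `F(0)² ≥ 0`. -/
theorem eLpNorm_two_circleTrace_le {F : Polynomial ℂ} (h0 : (F.eval 0).im = 0) :
    eLpNorm (circleTrace F) 2 periodMeasure
      ≤ ENNReal.ofReal (2 ^ (2 : ℝ)⁻¹) *
        eLpNorm (fun t => (circleTrace F t).re) 2 periodMeasure := by
  have hcont := continuous_circleTrace F
  have hre : Continuous fun t => (circleTrace F t).re := Complex.continuous_re.comp hcont
  refine eLpNorm_le_of_integral_rpow_le two_ne_zero ENNReal.ofNat_ne_top
    (memLp_of_continuous hcont 2) (memLp_of_continuous hre 2) zero_le_two ?_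
  simp only [ENNReal.toReal_ofNat, Real.rpow_ofNat]
  have i₂ : Integrable (fun t => ‖(circleTrace F t).re‖ ^ 2) periodMeasure :=
    integrable_of_continuous (hre.norm.pow 2)
  have i₃ : Integrable (fun t => circleTrace F t ^ 2) periodMeasure :=
    integrable_of_continuous (hcont.pow 2)
  have i₄ : Integrable (fun t => (circleTrace F t ^ 2).re) periodMeasure := i₃.re
  have hm : 0 ≤ ∫ t, (circleTrace F t ^ 2).re ∂periodMeasure := by
    have h1 := congrArg Complex.re (integral_sq_circleTrace F)
    have h2 : (∫ t, circleTrace F t ^ 2 ∂periodMeasure).re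
        = ∫ t, (circleTrace F t ^ 2).re ∂periodMeasure := (integral_re i₃).symm
    rw [← h2, h1]
    have h4 : F.eval 0 = ((F.eval 0).re : ℂ) := Complex.ext (by simp) (by simp [h0])
    rw [h4, ← Complex.ofReal_pow, ← Complex.ofReal_mul, Complex.ofReal_re]
    exact mul_nonneg Real.two_pi_pos.le (sq_nonneg _)
  have hpt : ∀ t, ‖circleTrace F t‖ ^ 2
      = 2 * ‖(circleTrace F t).re‖ ^ 2 - (circleTrace F t ^ 2).re := fun t => by
    rw [← Complex.normSq_eq_norm_sq, Complex.normSq_apply, Real.norm_eq_abs, sq_abs, sq, sq,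
      Complex.mul_re]
    ring
  simp_rw [hpt]
  rw [integral_sub (i₂.const_mul 2) i₄, integral_const_mul]
  linarith

/-! ### Trigonometric polynomials and Riesz's inequality for all polynomials -/

/-- The trigonometric polynomial `∑ c_k e^{ikt}` with finitely supported coefficients `c`. -/
noncomputable def trigPoly (c : ℤ →₀ ℂ) (t : ℝ) : ℂ :=
  c.sum fun k z => z * Complex.exp (k * t * Complex.I)

theorem trigPoly_zero (t : ℝ) : trigPoly 0 t = 0 := by simp [trigPoly]

theorem trigPoly_add (c d : ℤ →₀ ℂ) (t : ℝ) :
    trigPoly (c + d) t = trigPoly c t + trigPoly d t := by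
  unfold trigPoly
  exact Finsupp.sum_add_index' (by simp) (by intros; ring)

theorem trigPoly_single (k : ℤ) (z : ℂ) (t : ℝ) :
    trigPoly (Finsupp.single k z) t = z * Complex.exp (k * t * Complex.I) := by
  simp [trigPoly]

theorem continuous_trigPoly (c : ℤ →₀ ℂ) : Continuous (trigPoly c) := by
  unfold trigPoly Finsupp.sum
  fun_prop

/-- Real and imaginary parts of a trigonometric polynomial are real parts of analytic
polynomials, and these recover its projection to the frequencies `k ≥ 0`. -/
theorem exists_re_im_trigPoly (c : ℤ →₀ ℂ) : ∃ F G : Polynomial ℂ,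
    (F.eval 0).im = 0 ∧ (G.eval 0).im = 0 ∧
    ∀ t, (trigPoly c t).re = (circleTrace F t).re ∧ (trigPoly c t).im = (circleTrace G t).re ∧
      circleTrace F t + Complex.I * circleTrace G t
        = 2 * trigPoly (c.filter (0 ≤ ·)) t - c 0 := by
  induction c using Finsupp.induction_linear with
  | zero =>
    exact ⟨0, 0, by simp, by simp, fun t => by
      simp [circleTrace, trigPoly_zero, Finsupp.filter_zero]⟩
  | add c d hc hd =>
    obtain ⟨F, G, hF, hG, h⟩ := hc
    obtain ⟨F', G', hF', hG', h'⟩ := hd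
    refine ⟨F + F', G + G', by simp [hF, hF'], by simp [hG, hG'], fun t => ?_⟩
    obtain ⟨h1, h2, h3⟩ := h t
    obtain ⟨h1', h2', h3'⟩ := h' t
    simp only [circleTrace, Polynomial.eval_add, Complex.add_re, Complex.add_im,
      trigPoly_add, Finsupp.filter_add, Finsupp.add_apply] at *
    refine ⟨by rw [h1, h1'], by rw [h2, h2'], by linear_combination h3 + h3'⟩
  | single k z =>
    have hexp : ∀ (m : ℕ) (t : ℝ), Complex.exp (t * Complex.I) ^ m
        = Complex.exp (m * t * Complex.I) := fun m t => by
      rw [← Complex.exp_nat_mul]; ring_nf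
    rcases lt_trichotomy k 0 with hk | rfl | hk
    · obtain ⟨m, rfl⟩ : ∃ m : ℕ, k = -((m : ℤ) + 1) := ⟨(-k - 1).toNat, by omega⟩
      have hconj : ∀ t : ℝ, Complex.exp (((-((m : ℤ) + 1) : ℤ) : ℂ) * t * Complex.I)
          = (starRingEnd ℂ) (Complex.exp (((m + 1 : ℕ) : ℂ) * t * Complex.I)) := fun t => by
        rw [← Complex.exp_conj]; simp; ring_nf
      refine ⟨Polynomial.monomial (m + 1) ((starRingEnd ℂ) z),
        Polynomial.monomial (m + 1) (Complex.I * (starRingEnd ℂ) z), by simp, by simp,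
        fun t => ?_⟩
      rw [Finsupp.filter_single_of_neg _ (by omega), trigPoly_zero,
        Finsupp.single_eq_of_ne (by omega), trigPoly_single, hconj]
      simp only [circleTrace, Polynomial.eval_monomial, hexp]
      refine ⟨by simp, by simp; ring, ?_⟩
      linear_combination (starRingEnd ℂ) z * Complex.exp (((m + 1 : ℕ) : ℂ) * t * Complex.I)
        * Complex.I_mul_I
    · refine ⟨Polynomial.C (z.re : ℂ), Polynomial.C (z.im : ℂ), by simp, by simp, fun t => ?_⟩
      rw [Finsupp.filter_single_of_pos _ le_rfl, trigPoly_single]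
      simp only [circleTrace, Polynomial.eval_C]
      refine ⟨by simp, by simp, ?_⟩
      have := Complex.re_add_im z
      simp only [Int.cast_zero, zero_mul, Complex.exp_zero, mul_one, Finsupp.single_eq_same]
      linear_combination this
    · obtain ⟨m, rfl⟩ : ∃ m : ℕ, k = (m : ℤ) + 1 := ⟨(k - 1).toNat, by omega⟩
      refine ⟨Polynomial.monomial (m + 1) z, Polynomial.monomial (m + 1) (-Complex.I * z),
        by simp, by simp, fun t => ?_⟩
      rw [Finsupp.filter_single_of_pos _ (by omega), trigPoly_single,
        Finsupp.single_eq_of_ne (by omega)]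
      simp only [circleTrace, Polynomial.eval_monomial, hexp]
      push_cast
      refine ⟨rfl, by simp, ?_⟩
      linear_combination -z * Complex.exp ((m + 1) * t * Complex.I) * Complex.I_mul_I

local instance factTwoPiPos : Fact (0 < 2 * Real.pi) := ⟨Real.two_pi_pos⟩

/-- Uniform density of trigonometric polynomials among continuous functions on the circle. -/
theorem exists_trigPoly_near (u : C(AddCircle (2 * Real.pi), ℂ)) {ε : ℝ} (hε : 0 < ε) :
    ∃ c : ℤ →₀ ℂ, ∀ t : ℝ, ‖u t - trigPoly c t‖ < ε := by
  have hu : u ∈ closure (Submodule.span ℂ (Set.range (fourier (T := 2 * Real.pi))) :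
      Set C(AddCircle (2 * Real.pi), ℂ)) := by
    rw [← Submodule.topologicalClosure_coe, span_fourier_closure_eq_top]
    trivial
  obtain ⟨v, hv, huv⟩ := Metric.mem_closure_iff.1 hu ε hε
  obtain ⟨c, rfl⟩ := Finsupp.mem_span_range_iff_exists_finsupp.1 hv
  refine ⟨c, fun t => ?_⟩
  have h1 : (c.sum fun i a => a • fourier (T := 2 * Real.pi) i) (t : AddCircle (2 * Real.pi))
      = trigPoly c t := by
    unfold trigPoly Finsupp.sum
    rw [ContinuousMap.sum_apply]
    refine Finset.sum_congr rfl fun k _ => ?_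
    rw [ContinuousMap.smul_apply, smul_eq_mul, fourier_coe_apply]
    congr 2
    have : (Real.pi : ℂ) ≠ 0 := by exact_mod_cast Real.pi_ne_zero
    push_cast
    field_simp
  rw [← h1]
  rw [dist_eq_norm] at huv
  exact (ContinuousMap.norm_coe_le_norm (u - _) (t : AddCircle (2 * Real.pi))).trans_lt huv

/-- Continuous real functions on the circle are uniform limits of real parts of polynomials. -/
theorem exists_re_circleTrace_near (u : C(AddCircle (2 * Real.pi), ℝ)) {ε : ℝ} (hε : 0 < ε) :
    ∃ F : Polynomial ℂ, (F.eval 0).im = 0 ∧ ∀ t : ℝ, |u t - (circleTrace F t).re| < ε := by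
  obtain ⟨c, hc⟩ := exists_trigPoly_near
    ((⟨Complex.ofReal, Complex.continuous_ofReal⟩ : C(ℝ, ℂ)).comp u) hε
  obtain ⟨F, G, hF, -, h⟩ := exists_re_im_trigPoly c
  refine ⟨F, hF, fun t => ?_⟩
  rw [← (h t).1]
  refine lt_of_le_of_lt ?_ (hc t)
  simpa using Complex.abs_re_le_norm ((u t : ℂ) - trigPoly c t)

/-- The trace of a polynomial descends to a continuous function on the additive circle. -/
theorem exists_continuousMap_circleTrace (F : Polynomial ℂ) :
    ∃ u : C(AddCircle (2 * Real.pi), ℂ), ∀ t : ℝ, u t = circleTrace F t := by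
  refine ⟨⟨fun x => F.eval (fourier 1 x), F.continuous.comp (map_continuous _)⟩, fun t => ?_⟩
  have : (Real.pi : ℂ) ≠ 0 := by exact_mod_cast Real.pi_ne_zero
  rw [ContinuousMap.coe_mk, fourier_coe_apply, circleTrace]
  congr 2
  push_cast
  field_simp

theorem eLpNorm_le_of_forall_norm_le {E : Type*} [NormedAddCommGroup E] {f : ℝ → E} {ε : ℝ}
    (h : ∀ t, ‖f t‖ ≤ ε) (p : ℝ≥0∞) :
    eLpNorm f p periodMeasure ≤ periodMeasure Set.univ ^ p.toReal⁻¹ * ENNReal.ofReal ε :=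
  eLpNorm_le_of_ae_bound (Eventually.of_forall h)

theorem measure_rpow_ne_top {x : ℝ} (hx : 0 ≤ x) : periodMeasure Set.univ ^ x ≠ ⊤ :=
  ENNReal.rpow_ne_top_of_nonneg hx (measure_ne_top _ _)

theorem le_of_forall_le_add_mul {x y D : ℝ≥0∞} (hD : D ≠ ⊤)
    (h : ∀ ε : ℝ, 0 < ε → x ≤ y + D * ENNReal.ofReal ε) : x ≤ y := by
  have h1 : Tendsto (fun ε : ℝ => y + D * ENNReal.ofReal ε) (𝓝[>] 0) (𝓝 (y + D * 0)) := by
    refine Tendsto.const_add _ (ENNReal.Tendsto.const_mul ?_ (Or.inr hD))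
    have := (ENNReal.continuous_ofReal.tendsto 0).mono_left (nhdsWithin_le_nhds (s := Set.Ioi 0))
    rwa [ENNReal.ofReal_zero] at this
  rw [mul_zero, add_zero] at h1
  exact ge_of_tendsto h1 (eventually_nhdsWithin_of_forall fun ε hε => h ε hε)

/-- **M. Riesz's inequality** for polynomials: the real part controls the whole polynomial
in `L^p`, for `1 < p ≤ 2`. The positive and negative parts of `Re F` are approximated uniformly
by positive `Re G₁`, `Re G₂`; the remainder is small in `L²`. -/
theorem exists_eLpNorm_circleTrace_le {p : ℝ≥0∞} (hp1 : 1 < p) (hp2 : p ≤ 2) :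
    ∃ C : ℝ≥0∞, C ≠ ⊤ ∧ ∀ F : Polynomial ℂ, (F.eval 0).im = 0 →
      eLpNorm (circleTrace F) p periodMeasure
        ≤ C * eLpNorm (fun t => (circleTrace F t).re) p periodMeasure := by
  obtain ⟨C, hC, hpos⟩ := exists_eLpNorm_le_of_re_pos hp1 hp2
  refine ⟨2 * C, ENNReal.mul_ne_top ENNReal.ofNat_ne_top hC, fun F hF => ?_⟩
  set P := periodMeasure Set.univ with hP
  set K := P ^ (1 / p.toReal - 1 / (2 : ℝ≥0∞).toReal) with hK
  have hp : p ≠ ⊤ := ne_top_of_le_ne_top ENNReal.ofNat_ne_top hp2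
  have hq1 : 0 < p.toReal := ENNReal.toReal_pos (one_pos.trans hp1).ne' hp
  have hq2 : p.toReal ≤ 2 := by
    simpa using (ENNReal.toReal_le_toReal hp ENNReal.ofNat_ne_top).2 hp2
  have hKt : K ≠ ⊤ := measure_rpow_ne_top (by
    rw [ENNReal.toReal_ofNat, sub_nonneg]
    exact one_div_le_one_div_of_le hq1 hq2)
  have hPt : ∀ p : ℝ≥0∞, P ^ p.toReal⁻¹ ≠ ⊤ := fun p =>
    measure_rpow_ne_top (inv_nonneg.2 ENNReal.toReal_nonneg)
  set L := ENNReal.ofReal (2 ^ (2 : ℝ)⁻¹) with hL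
  obtain ⟨w, hw⟩ := exists_continuousMap_circleTrace F
  have hcF := continuous_circleTrace F
  have hre : ∀ G, Continuous fun t => (circleTrace G t).re := fun G =>
    Complex.continuous_re.comp (continuous_circleTrace G)
  refine le_of_forall_le_add_mul
    (D := C * (P ^ p.toReal⁻¹ * 2) + C * (P ^ p.toReal⁻¹ * 2)
      + L * (P ^ (2 : ℝ≥0∞).toReal⁻¹) * K) ?_ fun ε hε => ?_
  · refine ENNReal.add_ne_top.2 ⟨ENNReal.add_ne_top.2 ⟨?_, ?_⟩, ?_⟩
    · exact ENNReal.mul_ne_top hC (ENNReal.mul_ne_top (hPt p) ENNReal.ofNat_ne_top)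
    · exact ENNReal.mul_ne_top hC (ENNReal.mul_ne_top (hPt p) ENNReal.ofNat_ne_top)
    · exact ENNReal.mul_ne_top (ENNReal.mul_ne_top ENNReal.ofReal_ne_top (hPt 2)) hKt
  have happ : ∀ σ : ℝ, ∃ G : Polynomial ℂ, (G.eval 0).im = 0 ∧ ∀ t : ℝ,
      |max (σ * (circleTrace F t).re) 0 + ε - (circleTrace G t).re| < ε / 2 := by
    intro σ
    obtain ⟨G, hG, h⟩ := exists_re_circleTrace_near
      (⟨fun x => max (σ * (w x).re) 0 + ε, by fun_prop⟩ : C(AddCircle (2 * Real.pi), ℝ))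
      (half_pos hε)
    exact ⟨G, hG, fun t => by rw [← hw t]; exact h t⟩
  have hbound : ∀ σ : ℝ, |σ| = 1 → ∀ G : Polynomial ℂ, (G.eval 0).im = 0 →
      (∀ t : ℝ, |max (σ * (circleTrace F t).re) 0 + ε - (circleTrace G t).re| < ε / 2) →
      eLpNorm (circleTrace G) p periodMeasure
        ≤ C * eLpNorm (fun t => (circleTrace F t).re) p periodMeasure
          + C * (P ^ p.toReal⁻¹ * 2) * ENNReal.ofReal ε := by
    intro σ hσ G hG h
    refine (hpos G (ε / 2) (half_pos hε) (fun t => ?_) hG).trans ?_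
    · have := abs_lt.1 (h t)
      have := le_max_right (σ * (circleTrace F t).re) 0
      linarith
    · rw [mul_assoc C, ← mul_add]
      gcongr
      have h1 : eLpNorm (fun t => (circleTrace G t).re) p periodMeasure
          ≤ eLpNorm (fun t => |(circleTrace F t).re| + 2 * ε) p periodMeasure := by
        refine eLpNorm_mono_real fun t => ?_
        have h2 := abs_lt.1 (h t)
        have h3 := le_max_right (σ * (circleTrace F t).re) 0
        have h4 : max (σ * (circleTrace F t).re) 0 ≤ |(circleTrace F t).re| := by
          refine max_le ((le_abs_self _).trans ?_) (abs_nonneg _)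
          rw [abs_mul, hσ, one_mul]
        rw [Real.norm_eq_abs, abs_le]
        constructor <;> linarith
      refine h1.trans ((eLpNorm_add_le (hre F).abs.aestronglyMeasurable
        aestronglyMeasurable_const hp1.le).trans (add_le_add ?_ ?_))
      · exact eLpNorm_mono fun t => by simp
      · refine (eLpNorm_le_of_forall_norm_le (ε := 2 * ε)
          (fun t => (Real.norm_of_nonneg (by linarith)).le) p).trans (le_of_eq ?_)
        rw [ENNReal.ofReal_mul zero_le_two, ENNReal.ofReal_ofNat, mul_assoc]
  -- `σ = 1` gives the positive part of `Re F`, `σ = -1` the negative part.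
  obtain ⟨G₁, hG₁, h₁⟩ := happ 1
  obtain ⟨G₂, hG₂, h₂⟩ := happ (-1)
  have b₁ := hbound 1 (by simp) G₁ hG₁ h₁
  have b₂ := hbound (-1) (by simp) G₂ hG₂ h₂
  have hR : ∀ t, ‖(circleTrace (F - G₁ + G₂) t).re‖ ≤ ε := fun t => by
    have h3 := abs_lt.1 (h₁ t)
    have h4 := abs_lt.1 (h₂ t)
    have h5 : max (1 * (circleTrace F t).re) 0 - max (-1 * (circleTrace F t).re) 0
        = (circleTrace F t).re := by
      rcases le_total 0 (circleTrace F t).re with h | h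
      · rw [max_eq_left (by linarith), max_eq_right (by linarith)]; ring
      · rw [max_eq_right (by linarith), max_eq_left (by linarith)]; ring
    have h6 : (circleTrace (F - G₁ + G₂) t).re
        = (circleTrace F t).re - (circleTrace G₁ t).re + (circleTrace G₂ t).re := by
      simp [circleTrace]
    rw [h6, Real.norm_eq_abs, abs_le]
    constructor <;> linarith
  have b₃ : eLpNorm (circleTrace (F - G₁ + G₂)) p periodMeasure
      ≤ L * (P ^ (2 : ℝ≥0∞).toReal⁻¹) * K * ENNReal.ofReal ε := by
    calc eLpNorm (circleTrace (F - G₁ + G₂)) p periodMeasure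
        ≤ eLpNorm (circleTrace (F - G₁ + G₂)) 2 periodMeasure * K :=
          eLpNorm_le_eLpNorm_mul_rpow_measure_univ hp2
            (continuous_circleTrace _).aestronglyMeasurable
      _ ≤ (L * (P ^ (2 : ℝ≥0∞).toReal⁻¹ * ENNReal.ofReal ε)) * K := by
          gcongr
          refine (eLpNorm_two_circleTrace_le (by simp [hF, hG₁, hG₂])).trans ?_
          gcongr
          exact eLpNorm_le_of_forall_norm_le hR 2
      _ = _ := by ring
  have hsplit : circleTrace F
      = circleTrace G₁ + (fun t => -circleTrace G₂ t) + circleTrace (F - G₁ + G₂) := by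
    funext t
    simp [circleTrace]
    ring
  have m : ∀ G, AEStronglyMeasurable (circleTrace G) periodMeasure := fun G =>
    (continuous_circleTrace G).aestronglyMeasurable
  calc eLpNorm (circleTrace F) p periodMeasure
      ≤ eLpNorm (circleTrace G₁) p periodMeasure + eLpNorm (circleTrace G₂) p periodMeasure
        + eLpNorm (circleTrace (F - G₁ + G₂)) p periodMeasure := by
        conv_lhs => rw [hsplit]
        refine (eLpNorm_add_le ((m _).add (m _).neg) (m _) hp1.le).trans ?_
        gcongr
        refine (eLpNorm_add_le (m _) (m _).neg hp1.le).trans (le_of_eq ?_)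
        congr 1
        exact eLpNorm_neg (circleTrace G₂) p periodMeasure
    _ ≤ _ := add_le_add (add_le_add b₁ b₂) b₃
    _ = _ := by ring

/-! ### Frequency projections and Fourier partial sums of trigonometric polynomials -/

theorem integral_exp_int (k : ℤ) :
    ∫ t : ℝ, Complex.exp (k * t * Complex.I) ∂periodMeasure
      = if k = 0 then ((2 * Real.pi : ℝ) : ℂ) else 0 := by
  unfold periodMeasure
  rw [integral_Ico_eq_integral_Ioc, ← intervalIntegral.integral_of_le Real.two_pi_pos.le]
  split_ifs with hk
  · simp [hk]
  · have hk' : (k : ℂ) * Complex.I ≠ 0 :=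
      mul_ne_zero (Int.cast_ne_zero.2 hk) Complex.I_ne_zero
    have h1 : ∀ t : ℝ, Complex.exp (k * t * Complex.I) = Complex.exp (k * Complex.I * t) :=
      fun t => by ring_nf
    simp_rw [h1]
    rw [integral_exp_mul_complex hk']
    have h2 : (k : ℂ) * Complex.I * ((2 * Real.pi : ℝ) : ℂ) = k * (2 * Real.pi * Complex.I) := by
      push_cast; ring
    rw [h2, Complex.exp_int_mul_two_pi_mul_I]
    simp

theorem continuous_exp_int (k : ℤ) : Continuous fun t : ℝ => Complex.exp (k * t * Complex.I) := by
  fun_prop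

theorem integral_trigPoly (c : ℤ →₀ ℂ) :
    ∫ t, trigPoly c t ∂periodMeasure = (2 * Real.pi : ℝ) * c 0 := by
  induction c using Finsupp.induction_linear with
  | zero => simp [trigPoly_zero]
  | add c d hc hd =>
    simp_rw [trigPoly_add]
    rw [integral_add (integrable_of_continuous (continuous_trigPoly c))
      (integrable_of_continuous (continuous_trigPoly d)), hc, hd, Finsupp.add_apply, mul_add]
  | single k z =>
    simp_rw [trigPoly_single]
    rw [integral_const_mul, integral_exp_int, Finsupp.single_apply]
    split_ifs <;> ring

/-- `L^p` controls `L^1` on the period. -/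
theorem exists_integral_norm_le {p : ℝ≥0∞} (hp1 : 1 ≤ p) (hp : p ≠ ⊤) :
    ∃ C : ℝ≥0∞, C ≠ ⊤ ∧ ∀ f : ℝ → ℂ, AEStronglyMeasurable f periodMeasure →
      ENNReal.ofReal (∫ t, ‖f t‖ ∂periodMeasure) ≤ C * eLpNorm f p periodMeasure := by
  refine ⟨periodMeasure Set.univ ^ (1 / (1 : ℝ≥0∞).toReal - 1 / p.toReal),
    measure_rpow_ne_top ?_, fun f hf => ?_⟩
  · have : 1 ≤ p.toReal := by
      simpa using (ENNReal.toReal_le_toReal ENNReal.one_ne_top hp).2 hp1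
    rw [ENNReal.toReal_one, sub_nonneg]
    exact one_div_le_one_div_of_le one_pos this
  · rw [mul_comm, integral_norm_eq_lintegral_enorm hf, ← eLpNorm_one_eq_lintegral_enorm]
    exact ENNReal.ofReal_toReal_le.trans (eLpNorm_le_eLpNorm_mul_rpow_measure_univ hp1 hf)

/-- The projection onto the frequencies `k ≥ 0` is bounded in `L^p`, for `1 < p ≤ 2`. -/
theorem exists_eLpNorm_filter_nonneg_le {p : ℝ≥0∞} (hp1 : 1 < p) (hp2 : p ≤ 2) :
    ∃ C : ℝ≥0∞, C ≠ ⊤ ∧ ∀ c : ℤ →₀ ℂ,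
      eLpNorm (trigPoly (c.filter (0 ≤ ·))) p periodMeasure
        ≤ C * eLpNorm (trigPoly c) p periodMeasure := by
  have hp : p ≠ ⊤ := ne_top_of_le_ne_top ENNReal.ofNat_ne_top hp2
  obtain ⟨C, hC, hF⟩ := exists_eLpNorm_circleTrace_le hp1 hp2
  obtain ⟨K, hK, hL⟩ := exists_integral_norm_le hp1.le hp
  refine ⟨C + C + periodMeasure Set.univ ^ p.toReal⁻¹ * K, ENNReal.add_ne_top.2
    ⟨ENNReal.add_ne_top.2 ⟨hC, hC⟩, ENNReal.mul_ne_top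
      (measure_rpow_ne_top (inv_nonneg.2 ENNReal.toReal_nonneg)) hK⟩, fun c => ?_⟩
  obtain ⟨F, G, hF0, hG0, h⟩ := exists_re_im_trigPoly c
  have m : ∀ G, AEStronglyMeasurable (circleTrace G) periodMeasure := fun G =>
    (continuous_circleTrace G).aestronglyMeasurable
  have b₁ : eLpNorm (circleTrace F) p periodMeasure
      ≤ C * eLpNorm (trigPoly c) p periodMeasure := by
    refine (hF F hF0).trans ?_
    gcongr C * ?_
    exact eLpNorm_mono fun t => by rw [← (h t).1]; exact Complex.abs_re_le_norm _
  have b₂ : eLpNorm (circleTrace G) p periodMeasure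
      ≤ C * eLpNorm (trigPoly c) p periodMeasure := by
    refine (hF G hG0).trans ?_
    gcongr C * ?_
    exact eLpNorm_mono fun t => by rw [← (h t).2.1]; exact Complex.abs_im_le_norm _
  have h0 : ‖c 0‖ ≤ ∫ t, ‖trigPoly c t‖ ∂periodMeasure := by
    have h1 := norm_integral_le_integral_norm (μ := periodMeasure) (trigPoly c)
    rw [integral_trigPoly, norm_mul, Complex.norm_real,
      Real.norm_of_nonneg Real.two_pi_pos.le] at h1
    have := Real.pi_gt_three
    nlinarith [norm_nonneg (c 0)]
  have b₃ : eLpNorm (fun _ : ℝ => c 0) p periodMeasure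
      ≤ periodMeasure Set.univ ^ p.toReal⁻¹ * K * eLpNorm (trigPoly c) p periodMeasure := by
    refine (eLpNorm_le_of_forall_norm_le (fun _ => h0) p).trans ?_
    rw [mul_assoc]
    gcongr
    exact hL _ (continuous_trigPoly c).aestronglyMeasurable
  calc eLpNorm (trigPoly (c.filter (0 ≤ ·))) p periodMeasure
      ≤ eLpNorm (circleTrace F + (fun t => Complex.I * circleTrace G t) + fun _ => c 0)
          p periodMeasure := by
        refine eLpNorm_mono fun t => ?_
        have h3 : (circleTrace F + (fun t => Complex.I * circleTrace G t)
              + fun _ => c 0 : ℝ → ℂ) t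
            = 2 * trigPoly (c.filter (0 ≤ ·)) t := by
          simp only [Pi.add_apply]
          linear_combination (h t).2.2
        rw [h3, norm_mul, Complex.norm_ofNat]
        linarith [norm_nonneg (trigPoly (c.filter (0 ≤ ·)) t)]
    _ ≤ eLpNorm (circleTrace F) p periodMeasure + eLpNorm (circleTrace G) p periodMeasure
          + eLpNorm (fun _ : ℝ => c 0) p periodMeasure := by
        refine (eLpNorm_add_le ((m _).add ((m _).const_mul _)) aestronglyMeasurable_const
          hp1.le).trans ?_
        gcongr
        refine (eLpNorm_add_le (m _) ((m _).const_mul _) hp1.le).trans ?_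
        gcongr
        exact eLpNorm_mono fun t => by simp
    _ ≤ _ := add_le_add (add_le_add b₁ b₂) b₃
    _ = _ := by ring

theorem trigPoly_mapDomain_add (m : ℤ) (c : ℤ →₀ ℂ) (t : ℝ) :
    trigPoly (c.mapDomain (· + m)) t = Complex.exp (m * t * Complex.I) * trigPoly c t := by
  induction c using Finsupp.induction_linear with
  | zero => simp [trigPoly_zero, Finsupp.mapDomain_zero]
  | add c d hc hd => rw [Finsupp.mapDomain_add, trigPoly_add, trigPoly_add, hc, hd, mul_add]
  | single k z =>
    rw [Finsupp.mapDomain_single, trigPoly_single, trigPoly_single, mul_left_comm,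
      ← Complex.exp_add]
    push_cast
    ring_nf

/-- Shifting frequencies by `-m` turns the cut at `m` into the cut at `0`. -/
theorem filter_mapDomain_add (m : ℤ) (c : ℤ →₀ ℂ) :
    (c.filter (m ≤ ·)).mapDomain (· + -m) = (c.mapDomain (· + -m)).filter (0 ≤ ·) := by
  induction c using Finsupp.induction_linear with
  | zero => simp [Finsupp.filter_zero, Finsupp.mapDomain_zero]
  | add c d hc hd =>
    rw [Finsupp.mapDomain_add, Finsupp.filter_add, Finsupp.filter_add, Finsupp.mapDomain_add,
      hc, hd]
  | single k z =>
    rw [Finsupp.mapDomain_single]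
    by_cases h : m ≤ k
    · rw [Finsupp.filter_single_of_pos _ h, Finsupp.filter_single_of_pos _ (by omega),
        Finsupp.mapDomain_single]
    · rw [Finsupp.filter_single_of_neg _ h, Finsupp.filter_single_of_neg _ (by omega),
        Finsupp.mapDomain_zero]

theorem eLpNorm_trigPoly_mapDomain_add (m : ℤ) (c : ℤ →₀ ℂ) (p : ℝ≥0∞) :
    eLpNorm (trigPoly (c.mapDomain (· + m))) p periodMeasure
      = eLpNorm (trigPoly c) p periodMeasure := by
  refine eLpNorm_congr_norm_ae (Eventually.of_forall fun t => ?_)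
  have : ((m : ℂ) * t * Complex.I) = ((m * t : ℝ) : ℂ) * Complex.I := by push_cast; ring
  rw [trigPoly_mapDomain_add, norm_mul, this, Complex.norm_exp_ofReal_mul_I, one_mul]

/-- Multiplication by `e^{imt}` is an isometry, so the projections onto `k ≥ m` are bounded
uniformly in `m`. -/
theorem exists_eLpNorm_filter_le {p : ℝ≥0∞} (hp1 : 1 < p) (hp2 : p ≤ 2) :
    ∃ C : ℝ≥0∞, C ≠ ⊤ ∧ ∀ (m : ℤ) (c : ℤ →₀ ℂ),
      eLpNorm (trigPoly (c.filter (m ≤ ·))) p periodMeasure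
        ≤ C * eLpNorm (trigPoly c) p periodMeasure := by
  obtain ⟨C, hC, h⟩ := exists_eLpNorm_filter_nonneg_le hp1 hp2
  refine ⟨C, hC, fun m c => ?_⟩
  have h1 := h (c.mapDomain (· + -m))
  rwa [← filter_mapDomain_add, eLpNorm_trigPoly_mapDomain_add,
    eLpNorm_trigPoly_mapDomain_add] at h1

theorem integrable_mul_cos {f : ℝ → ℂ} (hf : Integrable f periodMeasure) (k : ℕ) :
    Integrable (fun t => f t * (Real.cos (k * t) : ℂ)) periodMeasure :=
  hf.mul_bdd (c := 1) (by fun_prop : Continuous _).aestronglyMeasurable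
    (Eventually.of_forall fun t => by
      rw [Complex.norm_real]; exact Real.abs_cos_le_one _)

theorem integrable_mul_sin {f : ℝ → ℂ} (hf : Integrable f periodMeasure) (k : ℕ) :
    Integrable (fun t => f t * (Real.sin (k * t) : ℂ)) periodMeasure :=
  hf.mul_bdd (c := 1) (by fun_prop : Continuous _).aestronglyMeasurable
    (Eventually.of_forall fun t => by
      rw [Complex.norm_real]; exact Real.abs_sin_le_one _)

theorem cosCoeff_add {f g : ℝ → ℂ} (hf : Integrable f periodMeasure)
    (hg : Integrable g periodMeasure) (k : ℕ) :
    cosCoeff (fun t => f t + g t) k = cosCoeff f k + cosCoeff g k := by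
  unfold cosCoeff
  simp_rw [add_mul]
  rw [integral_add (integrable_mul_cos hf k) (integrable_mul_cos hg k), mul_add]

theorem sinCoeff_add {f g : ℝ → ℂ} (hf : Integrable f periodMeasure)
    (hg : Integrable g periodMeasure) (k : ℕ) :
    sinCoeff (fun t => f t + g t) k = sinCoeff f k + sinCoeff g k := by
  unfold sinCoeff
  simp_rw [add_mul]
  rw [integral_add (integrable_mul_sin hf k) (integrable_mul_sin hg k), mul_add]

theorem fourierSum_add {f g : ℝ → ℂ} (hf : Integrable f periodMeasure)
    (hg : Integrable g periodMeasure) (n : ℕ) (t : ℝ) :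
    fourierSum (fun t => f t + g t) n t = fourierSum f n t + fourierSum g n t := by
  unfold fourierSum
  simp_rw [cosCoeff_add hf hg, sinCoeff_add hf hg, add_mul, mul_add]
  rw [add_add_add_comm, ← Finset.sum_add_distrib]
  congr 1
  exact Finset.sum_congr rfl fun _ _ => by ring

theorem continuous_fourierSum (f : ℝ → ℂ) (n : ℕ) : Continuous (fourierSum f n) := by
  unfold fourierSum
  fun_prop

theorem norm_cosCoeff_le {f : ℝ → ℂ} (hf : Integrable f periodMeasure) (k : ℕ) :
    ‖cosCoeff f k‖ ≤ ∫ t, ‖f t‖ ∂periodMeasure := by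
  unfold cosCoeff
  have h1 : ‖∫ t, f t * (Real.cos (k * t) : ℂ) ∂periodMeasure‖ ≤ ∫ t, ‖f t‖ ∂periodMeasure :=
    norm_integral_le_of_norm_le hf.norm (Eventually.of_forall fun t => by
      rw [norm_mul, Complex.norm_real]
      exact mul_le_of_le_one_right (norm_nonneg _) (Real.abs_cos_le_one _))
  have h2 : ‖1 / (Real.pi : ℂ)‖ ≤ 1 := by
    rw [norm_div, norm_one, Complex.norm_real, Real.norm_of_nonneg Real.pi_pos.le]
    exact (div_le_one Real.pi_pos).2 (by linarith [Real.pi_gt_three])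
  rw [norm_mul]
  exact (mul_le_of_le_one_left (norm_nonneg _) h2).trans h1

theorem norm_sinCoeff_le {f : ℝ → ℂ} (hf : Integrable f periodMeasure) (k : ℕ) :
    ‖sinCoeff f k‖ ≤ ∫ t, ‖f t‖ ∂periodMeasure := by
  unfold sinCoeff
  have h1 : ‖∫ t, f t * (Real.sin (k * t) : ℂ) ∂periodMeasure‖ ≤ ∫ t, ‖f t‖ ∂periodMeasure :=
    norm_integral_le_of_norm_le hf.norm (Eventually.of_forall fun t => by
      rw [norm_mul, Complex.norm_real]
      exact mul_le_of_le_one_right (norm_nonneg _) (Real.abs_sin_le_one _))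
  have h2 : ‖1 / (Real.pi : ℂ)‖ ≤ 1 := by
    rw [norm_div, norm_one, Complex.norm_real, Real.norm_of_nonneg Real.pi_pos.le]
    exact (div_le_one Real.pi_pos).2 (by linarith [Real.pi_gt_three])
  rw [norm_mul]
  exact (mul_le_of_le_one_left (norm_nonneg _) h2).trans h1

theorem norm_fourierSum_le {f : ℝ → ℂ} (hf : Integrable f periodMeasure) (n : ℕ) (t : ℝ) :
    ‖fourierSum f n t‖ ≤ (2 * n + 1) * ∫ t, ‖f t‖ ∂periodMeasure := by
  set I := ∫ t, ‖f t‖ ∂periodMeasure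
  have hI : 0 ≤ I := integral_nonneg fun _ => norm_nonneg _
  unfold fourierSum
  have h1 : ‖1 / 2 * cosCoeff f 0‖ ≤ I := by
    rw [norm_mul]
    have := norm_cosCoeff_le hf 0
    have h2 : ‖(1 / 2 : ℂ)‖ ≤ 1 := by norm_num
    exact (mul_le_of_le_one_left (norm_nonneg _) h2).trans this
  have h2 : ‖∑ k ∈ Finset.Icc 1 n, (cosCoeff f k * (Real.cos (k * t) : ℂ)
      + sinCoeff f k * (Real.sin (k * t) : ℂ))‖ ≤ ∑ k ∈ Finset.Icc 1 n, (I + I) := by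
    refine norm_sum_le_of_le _ fun k _ => (norm_add_le _ _).trans (add_le_add ?_ ?_)
    · rw [norm_mul, Complex.norm_real]
      exact (mul_le_of_le_one_right (norm_nonneg _) (Real.abs_cos_le_one _)).trans
        (norm_cosCoeff_le hf k)
    · rw [norm_mul, Complex.norm_real]
      exact (mul_le_of_le_one_right (norm_nonneg _) (Real.abs_sin_le_one _)).trans
        (norm_sinCoeff_le hf k)
  have h3 : ∑ k ∈ Finset.Icc 1 n, (I + I) = n * (I + I) := by simp; ring
  refine (norm_add_le _ _).trans ?_
  linarith

/-- For each fixed order `n`, the partial sum operator is bounded in `L^p`. -/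
theorem exists_eLpNorm_fourierSum_le_of_fixed {p : ℝ≥0∞} (hp1 : 1 ≤ p) (hp : p ≠ ⊤) (n : ℕ) :
    ∃ C : ℝ≥0∞, C ≠ ⊤ ∧ ∀ f : ℝ → ℂ, MemLp f p periodMeasure →
      eLpNorm (fourierSum f n) p periodMeasure ≤ C * eLpNorm f p periodMeasure := by
  obtain ⟨K, hK, hL⟩ := exists_integral_norm_le hp1 hp
  refine ⟨periodMeasure Set.univ ^ p.toReal⁻¹ * (ENNReal.ofReal (2 * n + 1) * K),
    ENNReal.mul_ne_top (measure_rpow_ne_top (inv_nonneg.2 ENNReal.toReal_nonneg))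
      (ENNReal.mul_ne_top ENNReal.ofReal_ne_top hK), fun f hf => ?_⟩
  refine (eLpNorm_le_of_forall_norm_le (norm_fourierSum_le (hf.integrable hp1) n) p).trans ?_
  rw [mul_assoc, ENNReal.ofReal_mul (by positivity), mul_assoc]
  gcongr
  exact hL f hf.1

theorem cosCoeff_exp (k : ℤ) (z : ℂ) (j : ℕ) :
    cosCoeff (fun t => z * Complex.exp (k * t * Complex.I)) j
      = z * ((if k = j then 1 else 0) + (if k = -j then 1 else 0)) := by
  have h : ∀ t : ℝ, z * Complex.exp (k * t * Complex.I) * (Real.cos (j * t) : ℂ)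
      = z / 2 * (Complex.exp ((k + j : ℤ) * t * Complex.I)
        + Complex.exp ((k - j : ℤ) * t * Complex.I)) := fun t => by
    have e1 : Complex.exp ((k + j : ℤ) * t * Complex.I)
        = Complex.exp (k * t * Complex.I) * Complex.exp (j * t * Complex.I) := by
      rw [← Complex.exp_add]; push_cast; ring_nf
    have e2 : Complex.exp ((k - j : ℤ) * t * Complex.I)
        = Complex.exp (k * t * Complex.I) * Complex.exp (-(j * t) * Complex.I) := by
      rw [← Complex.exp_add]; push_cast; ring_nf
    rw [e1, e2, Complex.ofReal_cos, Complex.cos]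
    push_cast
    ring
  have hpi : (Real.pi : ℂ) ≠ 0 := by exact_mod_cast Real.pi_ne_zero
  unfold cosCoeff
  simp_rw [h]
  rw [integral_const_mul, integral_add (integrable_of_continuous (continuous_exp_int _))
    (integrable_of_continuous (continuous_exp_int _)), integral_exp_int, integral_exp_int]
  have c1 : (k + (j : ℤ) = 0) ↔ k = -j := by omega
  have c2 : (k - (j : ℤ) = 0) ↔ k = j := by omega
  simp only [c1, c2]
  split_ifs <;> push_cast <;> field_simp <;> ring

theorem sinCoeff_exp (k : ℤ) (z : ℂ) (j : ℕ) :
    sinCoeff (fun t => z * Complex.exp (k * t * Complex.I)) j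
      = z * Complex.I * ((if k = j then 1 else 0) - (if k = -j then 1 else 0)) := by
  have h : ∀ t : ℝ, z * Complex.exp (k * t * Complex.I) * (Real.sin (j * t) : ℂ)
      = z * Complex.I / 2 * (Complex.exp ((k - j : ℤ) * t * Complex.I)
        - Complex.exp ((k + j : ℤ) * t * Complex.I)) := fun t => by
    have e1 : Complex.exp ((k + j : ℤ) * t * Complex.I)
        = Complex.exp (k * t * Complex.I) * Complex.exp (j * t * Complex.I) := by
      rw [← Complex.exp_add]; push_cast; ring_nf
    have e2 : Complex.exp ((k - j : ℤ) * t * Complex.I)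
        = Complex.exp (k * t * Complex.I) * Complex.exp (-(j * t) * Complex.I) := by
      rw [← Complex.exp_add]; push_cast; ring_nf
    rw [e1, e2, Complex.ofReal_sin, Complex.sin]
    push_cast
    ring
  have hpi : (Real.pi : ℂ) ≠ 0 := by exact_mod_cast Real.pi_ne_zero
  unfold sinCoeff
  simp_rw [h]
  rw [integral_const_mul, integral_sub (integrable_of_continuous (continuous_exp_int _))
    (integrable_of_continuous (continuous_exp_int _)), integral_exp_int, integral_exp_int]
  have c1 : (k + (j : ℤ) = 0) ↔ k = -j := by omega
  have c2 : (k - (j : ℤ) = 0) ↔ k = j := by omega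
  simp only [c1, c2]
  split_ifs <;> push_cast <;> field_simp <;> ring

theorem fourierSum_exp (k : ℤ) (z : ℂ) (n : ℕ) (t : ℝ) :
    fourierSum (fun t => z * Complex.exp (k * t * Complex.I)) n t
      = if |k| ≤ n then z * Complex.exp (k * t * Complex.I) else 0 := by
  have hexp : ∀ r : ℝ, Complex.exp (r * Complex.I)
      = (Real.cos r : ℂ) + Real.sin r * Complex.I :=
    fun r => by rw [Complex.exp_mul_I]; push_cast; rfl
  have hterm : ∀ j ∈ Finset.Icc 1 n,
      (cosCoeff (fun t => z * Complex.exp (k * t * Complex.I)) j * (Real.cos (j * t) : ℂ)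
        + sinCoeff (fun t => z * Complex.exp (k * t * Complex.I)) j * (Real.sin (j * t) : ℂ))
      = if j = k.natAbs then z * Complex.exp (k * t * Complex.I) else 0 := by
    intro j hj
    have hj1 := (Finset.mem_Icc.1 hj).1
    rw [cosCoeff_exp, sinCoeff_exp]
    by_cases h1 : k = j
    · have h2 : k ≠ -j := by omega
      have h3 : j = k.natAbs := by omega
      rw [if_pos h1, if_neg h2, if_pos h3, h1]
      have := hexp (j * t)
      push_cast at this ⊢
      rw [this]; ring
    · by_cases h2 : k = -j
      · have h3 : j = k.natAbs := by omega
        rw [if_neg h1, if_pos h2, if_pos h3, h2]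
        have := hexp (-(j * t))
        rw [Real.cos_neg, Real.sin_neg] at this
        push_cast at this ⊢
        rw [show -(j : ℂ) * t = -(j * t) by ring, this]; ring
      · have h3 : j ≠ k.natAbs := by omega
        rw [if_neg h1, if_neg h2, if_neg h3]; ring
  unfold fourierSum
  rw [Finset.sum_congr rfl hterm, Finset.sum_ite_eq', cosCoeff_exp]
  by_cases hk : k = 0
  · subst hk; simp; ring
  · have h0 : k ≠ ((0 : ℕ) : ℤ) := by simpa using hk
    have h0' : k ≠ -((0 : ℕ) : ℤ) := by simpa using hk
    have hiff : k.natAbs ∈ Finset.Icc 1 n ↔ |k| ≤ n := by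
      rw [Finset.mem_Icc, Int.abs_eq_natAbs]; omega
    simp only [if_neg h0, if_neg h0', hiff]
    simp

theorem fourierSum_trigPoly (c : ℤ →₀ ℂ) (n : ℕ) (t : ℝ) :
    fourierSum (trigPoly c) n t = trigPoly (c.filter (|·| ≤ (n : ℤ))) t := by
  induction c using Finsupp.induction_linear with
  | zero =>
    have : trigPoly 0 = fun t : ℝ => 0 * Complex.exp ((0 : ℤ) * t * Complex.I) := by
      funext t; simp [trigPoly_zero]
    rw [this, fourierSum_exp, Finsupp.filter_zero, trigPoly_zero]
    simp
  | add c d hc hd =>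
    have : trigPoly (c + d) = fun t => trigPoly c t + trigPoly d t := by
      funext t; exact trigPoly_add c d t
    rw [this, fourierSum_add (integrable_of_continuous (continuous_trigPoly c))
      (integrable_of_continuous (continuous_trigPoly d)), hc, hd, Finsupp.filter_add,
      trigPoly_add]
  | single k z =>
    have : trigPoly (Finsupp.single k z) = fun t : ℝ => z * Complex.exp (k * t * Complex.I) := by
      funext t; exact trigPoly_single k z t
    rw [this, fourierSum_exp]
    split_ifs with h
    · rw [Finsupp.filter_single_of_pos (fun x : ℤ => |x| ≤ (n : ℤ)) h, trigPoly_single]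
    · rw [Finsupp.filter_single_of_neg (fun x : ℤ => |x| ≤ (n : ℤ)) h, trigPoly_zero]

theorem filter_abs_add_filter (c : ℤ →₀ ℂ) (n : ℕ) :
    c.filter (|·| ≤ (n : ℤ)) + c.filter ((n : ℤ) + 1 ≤ ·) = c.filter (-(n : ℤ) ≤ ·) := by
  ext k
  simp only [Finsupp.add_apply, Finsupp.filter_apply]
  have h : |k| ≤ (n : ℤ) ↔ -(n : ℤ) ≤ k ∧ k ≤ n := abs_le
  by_cases h1 : -(n : ℤ) ≤ k
  · by_cases h2 : k ≤ n
    · rw [if_pos (h.2 ⟨h1, h2⟩), if_neg (by omega), if_pos h1, add_zero]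
    · rw [if_neg (fun h3 => h2 (h.1 h3).2), if_pos (by omega), if_pos h1, zero_add]
  · rw [if_neg (fun h3 => h1 (h.1 h3).1), if_neg (by omega), if_neg h1, add_zero]

/-- The partial sums are differences of two shifted frequency projections. -/
theorem exists_eLpNorm_fourierSum_trigPoly_le {p : ℝ≥0∞} (hp1 : 1 < p) (hp2 : p ≤ 2) :
    ∃ C : ℝ≥0∞, C ≠ ⊤ ∧ ∀ (n : ℕ) (c : ℤ →₀ ℂ),
      eLpNorm (fourierSum (trigPoly c) n) p periodMeasure
        ≤ C * eLpNorm (trigPoly c) p periodMeasure := by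
  obtain ⟨C, hC, h⟩ := exists_eLpNorm_filter_le hp1 hp2
  refine ⟨C + C, ENNReal.add_ne_top.2 ⟨hC, hC⟩, fun n c => ?_⟩
  have h1 : fourierSum (trigPoly c) n
      = trigPoly (c.filter (-(n : ℤ) ≤ ·)) - trigPoly (c.filter ((n : ℤ) + 1 ≤ ·)) := by
    funext t
    rw [Pi.sub_apply, fourierSum_trigPoly, ← filter_abs_add_filter, trigPoly_add,
      add_sub_cancel_right]
  rw [h1, add_mul]
  exact (eLpNorm_sub_le (continuous_trigPoly _).aestronglyMeasurable
    (continuous_trigPoly _).aestronglyMeasurable hp1.le).trans (add_le_add (h _ _) (h _ _))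

/-! ### Convergence of Fourier series in `L^p` -/

/-- Density of trigonometric polynomials in `L^p` of the period. -/
theorem exists_trigPoly_eLpNorm_sub_le {p : ℝ≥0∞} (hp1 : 1 ≤ p) (hp : p ≠ ⊤) {f : ℝ → ℂ}
    (hf : MemLp f p periodMeasure) {ε : ℝ≥0∞} (hε : ε ≠ 0) :
    ∃ c : ℤ →₀ ℂ, eLpNorm (fun t => f t - trigPoly c t) p periodMeasure ≤ ε := by
  have hP : periodMeasure = volume.restrict (Set.Ioc 0 (0 + 2 * Real.pi)) := by
    unfold periodMeasure
    rw [zero_add]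
    exact restrict_Ico_eq_restrict_Ioc
  have hε2 : ε / 2 ≠ 0 := (ENNReal.half_pos hε).ne'
  have hlift : MemLp (AddCircle.liftIoc (2 * Real.pi) 0 f) p := (hP ▸ hf).memLp_liftIoc
  obtain ⟨g, hg, -⟩ := hlift.exists_boundedContinuous_eLpNorm_sub_le hp hε2
  have hg' : eLpNorm (fun t : ℝ => f t - g (t : AddCircle (2 * Real.pi))) p periodMeasure
      ≤ ε / 2 := by
    refine le_trans (le_of_eq ?_) hg
    rw [← eLpNorm_comp_measurePreserving (hlift.1.sub g.continuous.aestronglyMeasurable)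
      (AddCircle.measurePreserving_mk (2 * Real.pi) 0), ← hP]
    refine eLpNorm_congr_ae ?_
    rw [hP]
    refine (ae_restrict_iff' measurableSet_Ioc).2 (Eventually.of_forall fun t ht => ?_)
    simp only [Function.comp_apply, Pi.sub_apply]
    rw [AddCircle.liftIoc_coe_apply ht]
  obtain ⟨δ, hδ, hδε⟩ := ENNReal.exists_nnreal_pos_mul_lt
    (measure_rpow_ne_top (x := p.toReal⁻¹) (inv_nonneg.2 ENNReal.toReal_nonneg)) hε2
  obtain ⟨c, hc⟩ := exists_trigPoly_near g.toContinuousMap (ε := δ) hδ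
  refine ⟨c, ?_⟩
  have hgc : Continuous fun t : ℝ => g (t : AddCircle (2 * Real.pi)) :=
    g.continuous.comp (AddCircle.continuous_mk' _)
  have hsplit : (fun t => f t - trigPoly c t)
      = (fun t : ℝ => f t - g (t : AddCircle (2 * Real.pi)))
        + fun t : ℝ => g (t : AddCircle (2 * Real.pi)) - trigPoly c t := by
    funext t; simp
  rw [hsplit]
  refine (eLpNorm_add_le (hf.1.sub hgc.aestronglyMeasurable)
    (hgc.sub (continuous_trigPoly c)).aestronglyMeasurable hp1).trans ?_
  refine (add_le_add hg' ?_).trans (ENNReal.add_halves ε).le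
  refine (eLpNorm_le_of_forall_norm_le (fun t => (hc t).le) p).trans ?_
  rw [mul_comm, ENNReal.ofReal_coe_nnreal]
  exact hδε.le

theorem fourierSum_eq_sub_add {f : ℝ → ℂ} (hf : Integrable f periodMeasure) (c : ℤ →₀ ℂ)
    (n : ℕ) : fourierSum f n
      = fourierSum (fun t => f t - trigPoly c t) n + fourierSum (trigPoly c) n := by
  have hc := integrable_of_continuous (continuous_trigPoly c)
  have hsub : Integrable (fun t => f t - trigPoly c t) periodMeasure := hf.sub hc
  funext t
  rw [Pi.add_apply, ← fourierSum_add hsub hc]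
  congr 1
  funext t
  ring

/-- For `1 < p ≤ 2` the partial sum operators are bounded in `L^p` uniformly in the order. The bound
for a fixed order justifies passing to the limit from trigonometric polynomials. -/
theorem exists_eLpNorm_fourierSum_le_of_le_two {p : ℝ≥0∞} (hp1 : 1 < p) (hp2 : p ≤ 2) :
    ∃ C : ℝ≥0∞, C ≠ ⊤ ∧ ∀ (n : ℕ) (f : ℝ → ℂ), MemLp f p periodMeasure →
      eLpNorm (fourierSum f n) p periodMeasure ≤ C * eLpNorm f p periodMeasure := by
  have hp : p ≠ ⊤ := ne_top_of_le_ne_top ENNReal.ofNat_ne_top hp2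
  obtain ⟨C, hC, h⟩ := exists_eLpNorm_fourierSum_trigPoly_le hp1 hp2
  refine ⟨C, hC, fun n f hf => ?_⟩
  obtain ⟨K, hK, hL⟩ := exists_eLpNorm_fourierSum_le_of_fixed hp1.le hp n
  refine le_of_forall_le_add_mul (D := K + C) (ENNReal.add_ne_top.2 ⟨hK, hC⟩) fun ε hε => ?_
  obtain ⟨c, hc⟩ := exists_trigPoly_eLpNorm_sub_le hp1.le hp hf
    (ENNReal.ofReal_pos.2 hε).ne'
  have hcm := memLp_of_continuous (continuous_trigPoly c) p
  have hsub : MemLp (fun t => f t - trigPoly c t) p periodMeasure := hf.sub hcm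
  have h1 : eLpNorm (trigPoly c) p periodMeasure
      ≤ eLpNorm f p periodMeasure + ENNReal.ofReal ε := by
    have h2 : trigPoly c = f - fun t => f t - trigPoly c t := by funext t; simp
    conv_lhs => rw [h2]
    exact (eLpNorm_sub_le hf.1 hsub.1 hp1.le).trans (add_le_add_right hc _)
  rw [fourierSum_eq_sub_add (hf.integrable hp1.le) c]
  calc eLpNorm (fourierSum (fun t => f t - trigPoly c t) n + fourierSum (trigPoly c) n) p
        periodMeasure
      ≤ K * ENNReal.ofReal ε + C * (eLpNorm f p periodMeasure + ENNReal.ofReal ε) := by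
        refine (eLpNorm_add_le (continuous_fourierSum _ n).aestronglyMeasurable
          (continuous_fourierSum _ n).aestronglyMeasurable hp1.le).trans (add_le_add ?_ ?_)
        · exact (hL _ hsub).trans (by gcongr)
        · exact (h n c).trans (by gcongr)
    _ = _ := by ring

theorem integral_fourierSum_mul (f : ℝ → ℂ) {g : ℝ → ℂ}
    (hg : Integrable g periodMeasure) (n : ℕ) :
    ∫ t, fourierSum f n t * g t ∂periodMeasure
      = Real.pi * (1 / 2 * cosCoeff f 0 * cosCoeff g 0 + ∑ k ∈ Finset.Icc 1 n,
        (cosCoeff f k * cosCoeff g k + sinCoeff f k * sinCoeff g k)) := by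
  have hpi : (Real.pi : ℂ) ≠ 0 := by exact_mod_cast Real.pi_ne_zero
  have hc : ∀ k : ℕ, ∫ t, g t * (Real.cos (k * t) : ℂ) ∂periodMeasure = Real.pi * cosCoeff g k :=
    fun k => by unfold cosCoeff; field_simp
  have hs : ∀ k : ℕ, ∫ t, g t * (Real.sin (k * t) : ℂ) ∂periodMeasure = Real.pi * sinCoeff g k :=
    fun k => by unfold sinCoeff; field_simp
  have h0 : ∫ t, g t ∂periodMeasure = Real.pi * cosCoeff g 0 := by
    rw [← hc 0]; simp
  have hexp : ∀ t, fourierSum f n t * g t = 1 / 2 * cosCoeff f 0 * g t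
      + ∑ k ∈ Finset.Icc 1 n, (cosCoeff f k * (g t * (Real.cos (k * t) : ℂ))
        + sinCoeff f k * (g t * (Real.sin (k * t) : ℂ))) := fun t => by
    unfold fourierSum
    rw [add_mul, Finset.sum_mul]
    congr 1
    exact Finset.sum_congr rfl fun k _ => by ring
  have hi : ∀ k, Integrable (fun t => cosCoeff f k * (g t * (Real.cos (k * t) : ℂ))
        + sinCoeff f k * (g t * (Real.sin (k * t) : ℂ))) periodMeasure := fun k =>
    ((integrable_mul_cos hg k).const_mul _).add ((integrable_mul_sin hg k).const_mul _)
  simp_rw [hexp]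
  rw [integral_add (hg.const_mul _) (integrable_finsetSum _ fun k _ => hi k),
    integral_const_mul, h0, integral_finsetSum _ fun k _ => hi k, mul_add, Finset.mul_sum]
  congr 1
  · ring
  · refine Finset.sum_congr rfl fun k _ => ?_
    rw [integral_add ((integrable_mul_cos hg k).const_mul _)
      ((integrable_mul_sin hg k).const_mul _), integral_const_mul, integral_const_mul, hc, hs]
    ring

/-- The partial sum operators are symmetric for the bilinear pairing. -/
theorem integral_fourierSum_mul_comm {f g : ℝ → ℂ} (hf : Integrable f periodMeasure)
    (hg : Integrable g periodMeasure) (n : ℕ) :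
    ∫ t, fourierSum f n t * g t ∂periodMeasure = ∫ t, f t * fourierSum g n t ∂periodMeasure := by
  have h : ∀ t, f t * fourierSum g n t = fourierSum g n t * f t := fun t => mul_comm _ _
  simp_rw [h]
  rw [integral_fourierSum_mul f hg, integral_fourierSum_mul g hf]
  congr 2
  · ring
  · exact Finset.sum_congr rfl fun k _ => by ring

/-- Duality: for exponents above `2` the bound follows by testing `S_n f` against
`conj (S_n f) |S_n f|^{p-2}` and moving `S_n` to the other factor. -/
theorem exists_eLpNorm_fourierSum_le_of_two_le {p : ℝ≥0∞} (hp2 : 2 ≤ p) (hp : p ≠ ⊤) :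
    ∃ C : ℝ≥0∞, C ≠ ⊤ ∧ ∀ (n : ℕ) (f : ℝ → ℂ), MemLp f p periodMeasure →
      eLpNorm (fourierSum f n) p periodMeasure ≤ C * eLpNorm f p periodMeasure := by
  set r := p.toReal with hr
  have hr2 : 2 ≤ r := by
    simpa using (ENNReal.toReal_le_toReal ENNReal.ofNat_ne_top hp).2 hp2
  set q : ℝ := Real.conjExponent r with hq
  have hconj : r.HolderConjugate q := Real.HolderConjugate.conjExponent (by linarith)
  have hq1 : 1 < q := hconj.symm.lt
  have hqr : (r - 1) * q = r := hconj.sub_one_mul_conj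
  have hq2 : q ≤ 2 := by nlinarith
  have hp0 : p ≠ 0 := (two_pos.trans_le hp2).ne'
  have hp1 : 1 ≤ p := one_le_two.trans hp2
  have hqE1 : 1 < ENNReal.ofReal q := by
    rw [← ENNReal.ofReal_one]; exact (ENNReal.ofReal_lt_ofReal_iff (by linarith)).2 hq1
  have hqE2 : ENNReal.ofReal q ≤ 2 := by
    rw [← ENNReal.ofReal_ofNat]; exact ENNReal.ofReal_le_ofReal hq2
  have hqR : (ENNReal.ofReal q).toReal = q := ENNReal.toReal_ofReal (by linarith)
  obtain ⟨C, hC, h⟩ := exists_eLpNorm_fourierSum_le_of_le_two hqE1 hqE2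
  refine ⟨C, hC, fun n f hf => ?_⟩
  have hfi : Integrable f periodMeasure := hf.integrable hp1
  set S := fourierSum f n with hS
  have hSc : Continuous S := continuous_fourierSum f n
  set g : ℝ → ℂ := fun t => (starRingEnd ℂ) (S t) * ((‖S t‖ ^ (r - 2) : ℝ) : ℂ) with hg
  have hgc : Continuous g :=
    (Complex.continuous_conj.comp hSc).mul (Complex.continuous_ofReal.comp
      (hSc.norm.rpow_const fun _ => Or.inr (by linarith)))
  have hgn : ∀ t, ‖g t‖ = ‖S t‖ ^ (r - 1) := fun t => by
    simp only [hg, norm_mul, RCLike.norm_conj, Complex.norm_real]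
    rw [Real.norm_of_nonneg (Real.rpow_nonneg (norm_nonneg _) _)]
    rcases eq_or_lt_of_le (norm_nonneg (S t)) with h0 | h0
    · rw [← h0, zero_mul, Real.zero_rpow (by linarith)]
    · rw [← Real.rpow_one_add' h0.le (by linarith)]
      congr 1; ring
  have hSg : ∀ t, S t * g t = ((‖S t‖ ^ r : ℝ) : ℂ) := fun t => by
    have h1 : S t * g t = ((‖S t‖ ^ 2 * ‖S t‖ ^ (r - 2) : ℝ) : ℂ) := by
      simp only [hg]
      rw [← mul_assoc, Complex.mul_conj, Complex.normSq_eq_norm_sq, ← Complex.ofReal_mul]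
    rw [h1]
    congr 1
    rcases eq_or_lt_of_le (norm_nonneg (S t)) with h0 | h0
    · rw [← h0, zero_pow two_ne_zero, zero_mul, Real.zero_rpow (by linarith)]
    · rw [← Real.rpow_natCast, ← Real.rpow_add h0]
      congr 1; push_cast; ring
  set X := ∫⁻ t, ‖S t‖ₑ ^ r ∂periodMeasure with hX
  have hN : eLpNorm S p periodMeasure = X ^ (1 / r) := by
    rw [eLpNorm_eq_lintegral_rpow_enorm_toReal hp0 hp]
  have hgq : eLpNorm g (ENNReal.ofReal q) periodMeasure = X ^ (1 / q) := by
    rw [eLpNorm_eq_lintegral_rpow_enorm_toReal (one_pos.trans hqE1).ne' ENNReal.ofReal_ne_top, hqR]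
    congr 1
    refine lintegral_congr fun t => ?_
    rw [← ofReal_norm, hgn, ← ENNReal.ofReal_rpow_of_nonneg (norm_nonneg _) (by linarith),
      ofReal_norm, ← ENNReal.rpow_mul, hqr]
  have hXeq : X = ‖∫ t, S t * g t ∂periodMeasure‖ₑ := by
    simp_rw [hSg]
    rw [integral_complex_ofReal, ← ofReal_norm, Complex.norm_real, Real.norm_of_nonneg
      (integral_nonneg fun t => Real.rpow_nonneg (norm_nonneg _) _),
      ofReal_integral_eq_lintegral_ofReal
      (integrable_of_continuous (hSc.norm.rpow_const fun _ => Or.inr (by linarith)))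
      (Eventually.of_forall fun t => Real.rpow_nonneg (norm_nonneg _) _)]
    refine lintegral_congr fun t => ?_
    rw [← ENNReal.ofReal_rpow_of_nonneg (norm_nonneg _) (by linarith), ofReal_norm]
  have hXtop : X ≠ ⊤ := by rw [hXeq]; exact enorm_ne_top
  have hgm := memLp_of_continuous hgc (ENNReal.ofReal q)
  have hmain : X ≤ eLpNorm f p periodMeasure * (C * X ^ (1 / q)) := by
    conv_lhs => rw [hXeq, hS, integral_fourierSum_mul_comm hfi (integrable_of_continuous hgc)]
    refine (enorm_integral_le_lintegral_enorm _).trans ?_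
    have hgS : AEStronglyMeasurable (fourierSum g n) periodMeasure :=
      (continuous_fourierSum g n).aestronglyMeasurable
    calc ∫⁻ t, ‖f t * fourierSum g n t‖ₑ ∂periodMeasure
        = ∫⁻ t, ((fun t => ‖f t‖ₑ) * fun t => ‖fourierSum g n t‖ₑ) t ∂periodMeasure :=
          lintegral_congr fun t => by rw [enorm_mul]; rfl
      _ ≤ (∫⁻ t, ‖f t‖ₑ ^ r ∂periodMeasure) ^ (1 / r)
            * (∫⁻ t, ‖fourierSum g n t‖ₑ ^ q ∂periodMeasure) ^ (1 / q) :=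
          ENNReal.lintegral_mul_le_Lp_mul_Lq _ hconj hf.1.enorm hgS.enorm
      _ = eLpNorm f p periodMeasure
            * eLpNorm (fourierSum g n) (ENNReal.ofReal q) periodMeasure := by
          rw [eLpNorm_eq_lintegral_rpow_enorm_toReal hp0 hp, eLpNorm_eq_lintegral_rpow_enorm_toReal
            (one_pos.trans hqE1).ne' ENNReal.ofReal_ne_top, hqR]
      _ ≤ _ := by
          gcongr
          rw [← hgq]
          exact h n g hgm
  rw [hN]
  rcases eq_or_ne X 0 with h0 | h0
  · rw [h0, ENNReal.zero_rpow_of_pos (by positivity)]; exact zero_le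
  · have hY0 : X ^ (1 / q) ≠ 0 := by
      intro h1
      rcases ENNReal.rpow_eq_zero_iff.1 h1 with h2 | h2
      · exact h0 h2.1
      · exact hXtop h2.1
    have hYt : X ^ (1 / q) ≠ ⊤ := ENNReal.rpow_ne_top_of_nonneg (by positivity) hXtop
    have hsplit : X = X ^ (1 / r) * X ^ (1 / q) := by
      rw [← ENNReal.rpow_add _ _ h0 hXtop, one_div, one_div, hconj.inv_add_inv_eq_one,
        ENNReal.rpow_one]
    refine (ENNReal.mul_le_mul_iff_left hY0 hYt).1 ?_
    rw [← hsplit]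
    refine hmain.trans (le_of_eq ?_)
    ring

/-- **M. Riesz's theorem**: for `1 < p < ∞` the Fourier partial sums of an `L^p` function converge
to it in `L^p`. -/
theorem tendsto_eLpNorm_fourierSum_sub {p : ℝ≥0∞} (hp1 : 1 < p) (hp : p ≠ ⊤) {f : ℝ → ℂ}
    (hf : MemLp f p periodMeasure) :
    Tendsto (fun n => eLpNorm (fun t => fourierSum f n t - f t) p periodMeasure) atTop (𝓝 0) := by
  obtain ⟨C, hC, h⟩ : ∃ C : ℝ≥0∞, C ≠ ⊤ ∧ ∀ (n : ℕ) (f : ℝ → ℂ), MemLp f p periodMeasure →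
      eLpNorm (fourierSum f n) p periodMeasure ≤ C * eLpNorm f p periodMeasure := by
    rcases le_total p 2 with h2 | h2
    · exact exists_eLpNorm_fourierSum_le_of_le_two hp1 h2
    · exact exists_eLpNorm_fourierSum_le_of_two_le h2 hp
  rw [ENNReal.tendsto_nhds_zero]
  intro ε hε
  obtain ⟨δ, hδ, hδε⟩ := ENNReal.exists_nnreal_pos_mul_lt
    (ENNReal.add_ne_top.2 ⟨hC, ENNReal.one_ne_top⟩) hε.ne'
  obtain ⟨c, hc⟩ := exists_trigPoly_eLpNorm_sub_le hp1.le hp hf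
    (ε := δ) (ENNReal.coe_pos.2 hδ).ne'
  have hsub : MemLp (fun t => f t - trigPoly c t) p periodMeasure :=
    hf.sub (memLp_of_continuous (continuous_trigPoly c) p)
  filter_upwards [eventually_ge_atTop (c.support.sup Int.natAbs)] with n hn
  have hfix : fourierSum (trigPoly c) n = trigPoly c := by
    funext t
    rw [fourierSum_trigPoly]
    congr 1
    refine Finsupp.filter_eq_self_iff _ _ |>.2 fun k hk => ?_
    have h1 := (Finset.le_sup (f := Int.natAbs) (Finsupp.mem_support_iff.2 hk)).trans hn
    rw [Int.abs_eq_natAbs]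
    exact_mod_cast h1
  have hsplit : (fun t => fourierSum f n t - f t)
      = fourierSum (fun t => f t - trigPoly c t) n - fun t => f t - trigPoly c t := by
    funext t
    rw [fourierSum_eq_sub_add (hf.integrable hp1.le) c, hfix]
    simp only [Pi.add_apply, Pi.sub_apply]
    ring
  rw [hsplit]
  refine (eLpNorm_sub_le (continuous_fourierSum _ n).aestronglyMeasurable hsub.1 hp1.le).trans ?_
  calc eLpNorm (fourierSum (fun t => f t - trigPoly c t) n) p periodMeasure
        + eLpNorm (fun t => f t - trigPoly c t) p periodMeasure
      ≤ C * δ + δ := add_le_add ((h n _ hsub).trans (by gcongr)) hc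
    _ = δ * (C + 1) := by ring
    _ ≤ ε := hδε.le

/-! ### Sufficiency of the coefficient condition -/

theorem tendsto_mean_prevWeight {lam : ℕ → ℝ} (hpos : ∀ k, 0 < lam k) (hmono : Monotone lam)
    {a : ℕ → ℂ} (h : Tendsto (fun n : ℕ => 1 / lam n * ∑ k ∈ Finset.Icc 1 n,
      lam (k - 1) * ‖a k‖) atTop (𝓝 0)) :
    Tendsto (fun n : ℕ => 1 / lam n * ∑ k ∈ Finset.range (n + 1),
      prevWeight lam k * (‖a k‖ + ‖a (k - 1)‖)) atTop (𝓝 0) := by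
  have h2 := h.add h
  rw [add_zero] at h2
  refine tendsto_of_tendsto_of_tendsto_of_le_of_le tendsto_const_nhds h2 (fun n => ?_)
    (fun n => ?_)
  · exact mul_nonneg (one_div_pos.2 (hpos n)).le (Finset.sum_nonneg fun k _ =>
      mul_nonneg (prevWeight_nonneg hpos k) (add_nonneg (norm_nonneg _) (norm_nonneg _)))
  · simp only []
    rw [← mul_add]
    refine mul_le_mul_of_nonneg_left ?_ (one_div_pos.2 (hpos n)).le
    set b : ℕ → ℝ := fun k => if k = 0 then 0 else lam (k - 1) * ‖a k‖ with hb
    have hb0 : ∀ k, 0 ≤ b k := fun k => by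
      simp only [hb]
      split_ifs
      · exact le_rfl
      · exact mul_nonneg (hpos _).le (norm_nonneg _)
    have hbsum : ∑ k ∈ Finset.Icc 1 n, lam (k - 1) * ‖a k‖ = ∑ k ∈ Finset.range (n + 1), b k := by
      rw [Finset.sum_range_succ', Finset.range_eq_Ico, Finset.sum_Ico_add' b 0 n 1]
      have : b 0 = 0 := by simp [hb]
      rw [this, add_zero]
      refine Finset.sum_congr (by ext k; simp) fun k hk => ?_
      rw [Finset.mem_Ico] at hk
      simp only [hb]
      rw [if_neg (by omega)]
    have hterm : ∀ k, prevWeight lam k * (‖a k‖ + ‖a (k - 1)‖) ≤ b k + b (k - 1) := by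
      intro k
      unfold prevWeight
      split_ifs with hk
      · rw [zero_mul]; exact add_nonneg (hb0 _) (hb0 _)
      · simp only [hb]
        rw [if_neg (by omega), if_neg (by omega), mul_add, show k - 1 - 1 = k - 2 by omega]
        gcongr
        exact hmono (by omega)
    have hshift : ∑ k ∈ Finset.range (n + 1), b (k - 1) ≤ ∑ k ∈ Finset.range (n + 1), b k := by
      rw [Finset.sum_range_succ']
      simp only [Nat.add_sub_cancel, Nat.zero_sub]
      have : b 0 = 0 := by simp [hb]
      rw [this, add_zero]
      exact Finset.sum_le_sum_of_subset_of_nonneg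
        (Finset.range_subset_range.2 (Nat.le_succ n)) fun _ _ _ => hb0 _
    rw [hbsum]
    calc ∑ k ∈ Finset.range (n + 1), prevWeight lam k * (‖a k‖ + ‖a (k - 1)‖)
        ≤ ∑ k ∈ Finset.range (n + 1), (b k + b (k - 1)) := Finset.sum_le_sum fun k _ => hterm k
      _ ≤ _ := by rw [Finset.sum_add_distrib]; linarith

/-- `Λ²`-strong convergence follows from `L^p` convergence of the partial sums together with
uniform smallness of the weighted increments. -/
theorem convergesStronglyInLp_of_tendsto {lam : ℕ → ℝ} (hpos : ∀ k, 0 < lam k)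
    (hmono : Monotone lam) (hlim : Tendsto lam atTop atTop) {p : ℝ≥0∞} (hp1 : 1 ≤ p)
    {a : ℕ → ℂ} {S : ℕ → ℝ → ℂ} {s : ℝ → ℂ} (hS : ∀ k, Continuous (S k))
    (hs : MemLp s p periodMeasure)
    (hinc : ∀ k, 2 ≤ k → ∀ t, ‖S k t - S (k - 2) t‖ ≤ ‖a k‖ + ‖a (k - 1)‖)
    (hconv : Tendsto (fun n => eLpNorm (fun t => S n t - s t) p periodMeasure) atTop (𝓝 0))
    (h : Tendsto (fun n : ℕ => 1 / lam n * ∑ k ∈ Finset.Icc 1 n,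
      lam (k - 1) * ‖a k‖) atTop (𝓝 0)) :
    ConvergesStronglyInLp lam 2 p periodMeasure S s := by
  refine ⟨hs, ?_⟩
  have hSs : ∀ k, MemLp (fun t => S k t - s t) p periodMeasure := fun k =>
    (memLp_of_continuous (hS k) p).sub hs
  set e : ℕ → ℝ := fun k => (eLpNorm (fun t => S k t - s t) p periodMeasure).toReal with he
  have he0 : Tendsto e atTop (𝓝 0) := by
    have := (ENNReal.tendsto_toReal ENNReal.zero_ne_top).comp hconv
    rwa [ENNReal.toReal_zero] at this
  have hw : ∀ k, 0 ≤ lam k - prevWeight lam k := fun k =>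
    sub_nonneg.2 (prevWeight_le hpos hmono k)
  have l₁ := tendsto_mean_prevWeight hpos hmono h
  have l₂ := tendsto_weighted_mean hpos hmono hlim he0
  set c : ℕ → ℝ := fun n => 1 / lam n * ∑ k ∈ Finset.range (n + 1),
      prevWeight lam k * (‖a k‖ + ‖a (k - 1)‖) with hc
  have hbound : ∀ n, eLpNorm (fun t => strongMean lam 2 (fun k => S k t) (s t) n) p periodMeasure
      ≤ periodMeasure Set.univ ^ p.toReal⁻¹ * ENNReal.ofReal (c n)
        + ENNReal.ofReal (1 / lam n * ∑ k ∈ Finset.range (n + 1),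
          (lam k - prevWeight lam k) * e k) := by
    intro n
    have hln : 0 ≤ 1 / lam n := (one_div_pos.2 (hpos n)).le
    have hcn : 0 ≤ c n := mul_nonneg hln (Finset.sum_nonneg fun k _ =>
      mul_nonneg (prevWeight_nonneg hpos k) (add_nonneg (norm_nonneg _) (norm_nonneg _)))
    have hterm : ∀ k t, ‖strongDiff lam (fun k => S k t) (s t) k‖
        ≤ prevWeight lam k * (‖a k‖ + ‖a (k - 1)‖)
          + (lam k - prevWeight lam k) * ‖S k t - s t‖ := by
      intro k t
      refine (norm_strongDiff_le hpos hmono (fun k => S k t) (s t) k).trans ?_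
      gcongr ?_ + _
      by_cases hk : k < 2
      · simp [prevWeight, hk]
      · exact mul_le_mul_of_nonneg_left (hinc k (not_lt.1 hk) t) (prevWeight_nonneg hpos k)
    set u : ℕ → ℝ → ℝ := fun k t => (lam k - prevWeight lam k) * ‖S k t - s t‖ with hu
    have hum : ∀ k, AEStronglyMeasurable (u k) periodMeasure := fun k =>
      (hSs k).1.norm.const_mul _
    have hun : ∀ k, eLpNorm (u k) p periodMeasure
        = ENNReal.ofReal ((lam k - prevWeight lam k) * e k) := fun k => by
      have h1 : u k = (lam k - prevWeight lam k) • fun t => ‖S k t - s t‖ := rfl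
      rw [h1, eLpNorm_const_smul, eLpNorm_norm, Real.enorm_eq_ofReal (hw k),
        ENNReal.ofReal_mul (hw k), he, ENNReal.ofReal_toReal (hSs k).2.ne]
    calc eLpNorm (fun t => strongMean lam 2 (fun k => S k t) (s t) n) p periodMeasure
        ≤ eLpNorm ((fun _ => c n) + (1 / lam n) • ∑ k ∈ Finset.range (n + 1), u k)
            p periodMeasure := by
          refine eLpNorm_mono_real fun t => ?_
          rw [Real.norm_of_nonneg
            ((norm_nonneg _).trans (norm_sub_le_strongMean hpos (fun k => S k t) _ _)),
            strongMean_two, Pi.add_apply, Pi.smul_apply, Finset.sum_apply, smul_eq_mul, hc,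
            ← mul_add, ← Finset.sum_add_distrib]
          exact mul_le_mul_of_nonneg_left (Finset.sum_le_sum fun k _ => hterm k t) hln
      _ ≤ eLpNorm (fun _ => c n) p periodMeasure
            + eLpNorm ((1 / lam n) • ∑ k ∈ Finset.range (n + 1), u k) p periodMeasure :=
          eLpNorm_add_le aestronglyMeasurable_const
            ((Finset.aestronglyMeasurable_sum _ fun k _ => hum k).const_smul _) hp1
      _ ≤ _ := by
          refine add_le_add (eLpNorm_le_of_forall_norm_le
            (fun _ => (Real.norm_of_nonneg hcn).le) p) ?_
          rw [eLpNorm_const_smul, Real.enorm_eq_ofReal hln, ENNReal.ofReal_mul hln,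
            ENNReal.ofReal_sum_of_nonneg fun k _ => mul_nonneg (hw k) ENNReal.toReal_nonneg]
          gcongr
          refine (eLpNorm_sum_le (fun k _ => hum k) hp1).trans (le_of_eq ?_)
          exact Finset.sum_congr rfl fun k _ => hun k
  have hlimit : Tendsto (fun n => periodMeasure Set.univ ^ p.toReal⁻¹ * ENNReal.ofReal (c n)
        + ENNReal.ofReal (1 / lam n * ∑ k ∈ Finset.range (n + 1),
          (lam k - prevWeight lam k) * e k)) atTop (𝓝 0) := by
    have t₁ := ENNReal.Tendsto.const_mul (ENNReal.tendsto_ofReal l₁)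
      (Or.inr (measure_rpow_ne_top (x := p.toReal⁻¹) (inv_nonneg.2 ENNReal.toReal_nonneg)))
    have t₂ := ENNReal.tendsto_ofReal l₂
    have := t₁.add t₂
    simpa using this
  exact tendsto_of_tendsto_of_tendsto_of_le_of_le tendsto_const_nhds hlimit
    (fun _ => zero_le) hbound

theorem HasCosineSeries.fourierSum_eq {f : ℝ → ℂ} {a : ℕ → ℂ} (h : HasCosineSeries f a) (n : ℕ)
    (t : ℝ) : fourierSum f n t = 1 / 2 * a 0 + cosSum a n t := by
  unfold fourierSum cosSum
  rw [h.1 0]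
  congr 1
  refine Finset.sum_congr rfl fun k hk => ?_
  rw [h.1 k, h.2 k (Finset.mem_Icc.1 hk).1, zero_mul, add_zero]

theorem HasSineSeries.fourierSum_eq {g : ℝ → ℂ} {a : ℕ → ℂ} (h : HasSineSeries g a) :
    fourierSum g = sinSum a := by
  funext n t
  unfold fourierSum sinSum
  rw [h.1 0, mul_zero, zero_add]
  refine Finset.sum_congr rfl fun k hk => ?_
  rw [h.1 k, h.2 k (Finset.mem_Icc.1 hk).1, zero_mul, zero_add]

/-- Strong convergence depends only on the differences `s_k - s`, so a common summand may be moved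
from the terms to the limit. -/
theorem ConvergesStronglyInLp.congr_sub {lam : ℕ → ℝ} {r : ℕ} {p : ℝ≥0∞} {μ : Measure ℝ}
    {S T : ℕ → ℝ → ℂ} {s u : ℝ → ℂ} (h : ConvergesStronglyInLp lam r p μ S s)
    (hu : MemLp u p μ) (hST : ∀ k t, T k t - u t = S k t - s t) :
    ConvergesStronglyInLp lam r p μ T u := by
  refine ⟨hu, h.2.congr fun n => ?_⟩
  congr 1
  funext t
  simp only [strongMean, hST]

theorem norm_cosSum_sub_le (a : ℕ → ℂ) {k : ℕ} (hk : 2 ≤ k) (t : ℝ) :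
    ‖cosSum a k t - cosSum a (k - 2) t‖ ≤ ‖a k‖ + ‖a (k - 1)‖ := by
  rw [cosSum_sub a hk]
  refine (norm_add_le _ _).trans (add_le_add ?_ ?_) <;>
  · rw [norm_mul, Complex.norm_real]
    exact mul_le_of_le_one_right (norm_nonneg _) (Real.abs_cos_le_one _)

theorem norm_sinSum_sub_le (a : ℕ → ℂ) {k : ℕ} (hk : 2 ≤ k) (t : ℝ) :
    ‖sinSum a k t - sinSum a (k - 2) t‖ ≤ ‖a k‖ + ‖a (k - 1)‖ := by
  rw [sinSum_sub a hk]
  refine (norm_add_le _ _).trans (add_le_add ?_ ?_) <;>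
  · rw [norm_mul, Complex.norm_real]
    exact mul_le_of_le_one_right (norm_nonneg _) (Real.abs_sin_le_one _)

end LambdaStrong

theorem theorem4p6 (lam : ℕ → ℝ) (hpos : ∀ k, 0 < lam k) (hmono : Monotone lam)
    (hlim : Tendsto lam atTop atTop) (p : ℝ≥0∞) (hp1 : 1 ≤ p) (hp : p ≠ ⊤) (a : ℕ → ℂ) :
    (∀ A : Set ℝ, NullMeasurableSet A volume → 0 < volume A →
      (∃ s₁ : ℝ → ℂ, LambdaStrong.ConvergesStronglyInLp lam 2 p (volume.restrict A)
        (LambdaStrong.cosSum a) s₁) →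
      (∃ s₂ : ℝ → ℂ, LambdaStrong.ConvergesStronglyInLp lam 2 p (volume.restrict A)
        (LambdaStrong.sinSum a) s₂) →
      Tendsto (fun n : ℕ => 1 / lam n * ∑ k ∈ Finset.Icc 1 n, lam (k - 1) * ‖a k‖)
        atTop (𝓝 0)) ∧
    (1 < p → ∀ f g : ℝ → ℂ,
      MemLp f p LambdaStrong.periodMeasure → MemLp g p LambdaStrong.periodMeasure →
      LambdaStrong.HasCosineSeries f a → LambdaStrong.HasSineSeries g a →
      ((LambdaStrong.ConvergesStronglyInLp lam 2 p LambdaStrong.periodMeasure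
          (LambdaStrong.fourierSum f) f ∧
        LambdaStrong.ConvergesStronglyInLp lam 2 p LambdaStrong.periodMeasure
          (LambdaStrong.fourierSum g) g) ↔
      Tendsto (fun n : ℕ => 1 / lam n * ∑ k ∈ Finset.Icc 1 n, lam (k - 1) * ‖a k‖)
        atTop (𝓝 0))) := by
  refine ⟨fun A _ hA ⟨s₁, h₁⟩ ⟨s₂, h₂⟩ =>
    LambdaStrong.tendsto_mean_of_convergesStrongly hpos hmono hlim hp1 hA h₁ h₂,
    fun hp1' f g hf hg hfa hga => ⟨fun ⟨h₁, h₂⟩ => ?_, fun h => ⟨?_, ?_⟩⟩⟩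
  · rw [hga.fourierSum_eq] at h₂
    -- The cosine sums lack the constant term `a₀ / 2`, so their limit is `f - a₀ / 2`.
    have h₁' := h₁.congr_sub (T := LambdaStrong.cosSum a) (u := fun t => f t - 1 / 2 * a 0)
      (hf.sub (memLp_const _)) fun k t => by rw [hfa.fourierSum_eq]; ring
    refine LambdaStrong.tendsto_mean_of_convergesStrongly hpos hmono hlim hp1
      (A := Set.Ico 0 (2 * Real.pi)) ?_ h₁' h₂
    rw [Real.volume_Ico]
    simpa using Real.pi_pos
  · refine LambdaStrong.convergesStronglyInLp_of_tendsto hpos hmono hlim hp1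
      (LambdaStrong.continuous_fourierSum f) hf (fun k hk t => ?_)
      (LambdaStrong.tendsto_eLpNorm_fourierSum_sub hp1' hp hf) h
    rw [hfa.fourierSum_eq, hfa.fourierSum_eq, add_sub_add_left_eq_sub]
    exact LambdaStrong.norm_cosSum_sub_le a hk t
  · refine LambdaStrong.convergesStronglyInLp_of_tendsto hpos hmono hlim hp1
      (LambdaStrong.continuous_fourierSum g) hg (fun k hk t => ?_)
      (LambdaStrong.tendsto_eLpNorm_fourierSum_sub hp1' hp hg) h
    rw [hga.fourierSum_eq]
    exact LambdaStrong.norm_sinSum_sub_le a hk t
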